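/- **Conventions.** A complex $m\times n$ matrix pencil is $L(\lambda)=\lambda B+A$ with $A,B\in\mathbb C^{m\times n}$; pencils converge when their coefficient matrices converge entrywise, and $\overline{\mathbb C}=\mathbb C\cup\{\infty\}$ is the Riemann sphere. The rank of $L$ is its rank as a matrix over $\mathbb C(\lambda)$. By Kronecker's theorem, there are invertible constant matrices $P,Q$ such that $PL(\lambda)Q$ is block diagonal, with diagonal blocks of the following forms, uniquely determined up to order (the Kronecker canonical form of $L$): Jordan blocks $(\lambda-\mu)I_k+N_k$ with eigenvalue $\mu\in\mathbb C$ ($k\ge1$), Jordan blocks $\lambda N_k+I_k$ with eigenvalue $\infty$ ($k\ge1$), where $N_k$ is the $k\times k$ matrix with ones on the first superdiagonal and zeros elsewhere, the $k\times(k+1)$ blocks $R_k(\lambda)$ with $\lambda$ in the positions $(i,i)$, $1$ in the positions $(i,i+1)$ and $0$ elsewhere ($k\ge0$), and the transposes $R_k(\lambda)^{\top}$ ($k\ge0$). The eigenvalues of $L$ are those of its Jordan blocks. For $\mu\in\overline{\mathbb C}$, the Weyr characteristic of $\mu$ in $L$ is $W(\mu,L)=(W_1(\mu,L),W_2(\mu,L),\dots)$,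 where $W_i(\mu,L)$ is the number of Jordan blocks with eigenvalue $\mu$ and size at least $i$. The bundle $\mathcal B(L)$ is the set of all pencils strictly equivalent to a pencil obtained from the Kronecker canonical form of $L$ by replacing each eigenvalue $\mu$ by $\varphi(\mu)$, without changing the block sizes, for some one-to-one map $\varphi:\overline{\mathbb C}\to\overline{\mathbb C}$. The union of finitely many non-increasing lists is the list of all their entries arranged in non-increasing order; lists are continued by zeros. We write $a\prec b$ if $\sum_{i=1}^{j}a_i\le\sum_{i=1}^{j}b_i$ for all $j\ge1$. **Theorem.** Let $L$ and $M$ be complex $m\times n$ matrix pencils, let $\{M_k\}_{k\in\mathbb N}$ be a sequence of complex $m\times n$ matrix pencils, and let $\mu\in\overline{\mathbb C}$. Suppose that 1. $M_k\in\mathcal B(L)$ for all $k\in\mathbb N$; 2. $\lambda_{1,k},\dots,\lambda_{s,k}\in\overline{\mathbb C}$ are distinct eigenvalues of $M_k$ for each $k\in\mathbb N$, and $W(\lambda_{i,k_1},M_{k_1})=W(\lambda_{i,k_2},M_{k_2})$ for all $i=1,\dots,s$ and all $k_1,k_2\in\mathbb N$; 3. $\{M_k\}_{k\in\mathbb N}$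 converges to $M$; 4. $\{\lambda_{i,k}\}_{k\in\mathbb N}$ converges to $\mu$ in $\overline{\mathbb C}$ for all $i=1,\dots,s$. Then, for every $k\in\mathbb N$, $$\bigcup_{i=1}^{s}W(\lambda_{i,k},M_k)\prec W(\mu,M)+(h,h,\dots),\qquad h:=\operatorname{rank}L-\operatorname{rank}M .$$ -/

import Mathlib

open scoped Topology OnePoint

/-- A complex matrix pencil `L(λ) = λ B + A`, stored as the pair `(B, A)`: `L.1` is the coefficient
of `λ` and `L.2` is the constant term.  As a product of spaces of complex matrices, the set of
`m × n` pencils is `ℂ^{2mn}` and carries its standard topology. -/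
abbrev Pencil (R C : Type) : Type := Matrix R C ℂ × Matrix R C ℂ

namespace Pencil

/-- The matrix `λ B + A` over the field of rational functions in the variable `λ`. -/
noncomputable def toRatFunc {R C : Type} (L : Pencil R C) : Matrix R C (RatFunc ℂ) :=
  (RatFunc.X : RatFunc ℂ) • L.1.map RatFunc.C + L.2.map RatFunc.C

/-- The (normal) rank of a pencil: its rank over the field of rational functions. -/
noncomputable def rank {R C : Type} [Fintype C] (L : Pencil R C) : ℕ :=
  L.toRatFunc.rank

/-- The orbit of a pencil under strict equivalence. -/
def orbit {R C : Type} [Fintype R] [DecidableEq R] [Fintype C] [DecidableEq C]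
    (L : Pencil R C) : Set (Pencil R C) :=
  {M | ∃ (P : GL R ℂ) (Q : GL C ℂ),
    M.1 = (P : Matrix R R ℂ) * L.1 * (Q : Matrix C C ℂ) ∧
    M.2 = (P : Matrix R R ℂ) * L.2 * (Q : Matrix C C ℂ)}

end Pencil

/-- The `k × k` matrix with ones on the first superdiagonal and zeros elsewhere. -/
def superdiag (k : ℕ) : Matrix (Fin k) (Fin k) ℂ :=
  Matrix.of fun i j => if (j : ℕ) = (i : ℕ) + 1 then 1 else 0

/-- The Jordan block `λ I_k + J_k(μ)` with finite eigenvalue `μ`; the matrix `J_k(μ)` has `-μ` on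
the diagonal and ones on the first superdiagonal. -/
def jordanFinite (μ : ℂ) (k : ℕ) : Pencil (Fin k) (Fin k) :=
  (1, (-μ) • (1 : Matrix (Fin k) (Fin k) ℂ) + superdiag k)

/-- The Jordan block `λ N_k + I_k` with infinite eigenvalue. -/
def jordanInfinite (k : ℕ) : Pencil (Fin k) (Fin k) :=
  (superdiag k, 1)

/-- The `k × (k+1)` right singular block `R_k(λ)`: its entries are `λ` in the positions `(i, i)`,
`1` in the positions `(i, i+1)`, and `0` elsewhere. -/
def rightSingular (k : ℕ) : Pencil (Fin k) (Fin (k + 1)) :=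
  (Matrix.of fun i j => if (j : ℕ) = (i : ℕ) then 1 else 0,
   Matrix.of fun i j => if (j : ℕ) = (i : ℕ) + 1 then 1 else 0)

/-- Names of the canonical blocks: Jordan blocks of size `k ≥ 1` with eigenvalue in `ℂ ∪ {∞}`,
right singular blocks `R_k` and left singular blocks `R_kᵀ`, `k ≥ 0`. -/
inductive KBlock : Type
  | jordan (μ : OnePoint ℂ) (k : ℕ+) : KBlock
  | right (k : ℕ) : KBlock
  | left (k : ℕ) : KBlock

namespace KBlock

/-- Number of rows of a canonical block. -/
def rows : KBlock → ℕ
  | jordan _ k => k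
  | right k => k
  | left k => k + 1

/-- Number of columns of a canonical block. -/
def cols : KBlock → ℕ
  | jordan _ k => k
  | right k => k + 1
  | left k => k

/-- The canonical block itself, as a pencil. -/
def toPencil : (b : KBlock) → Pencil (Fin b.rows) (Fin b.cols)
  | jordan (OnePoint.some μ) k => jordanFinite μ k
  | jordan OnePoint.infty k => jordanInfinite k
  | right k => rightSingular k
  | left k => ((rightSingular k).1.transpose, (rightSingular k).2.transpose)

/-- Replace the eigenvalue `μ` of a Jordan block by `φ μ`, keeping the size; singular blocks are
unchanged. -/
def mapEigenvalue (φ : OnePoint ℂ → OnePoint ℂ) : KBlock → KBlock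
  | jordan μ k => jordan (φ μ) k
  | right k => right k
  | left k => left k

open Classical in
/-- The size of a Jordan block with eigenvalue `μ`, and `0` for every other canonical block. -/
noncomputable def sizeAt (μ : OnePoint ℂ) : KBlock → ℕ
  | jordan ν k => if ν = μ then k else 0
  | right _ => 0
  | left _ => 0

end KBlock

/-- A finite ordered family of canonical blocks. -/
abbrev KFamily : Type := Σ r : ℕ, Fin r → KBlock

namespace KFamily

/-- The block diagonal pencil with the given canonical blocks. -/
noncomputable def toPencil (K : KFamily) :
    Pencil (Σ i : Fin K.1, Fin (K.2 i).rows) (Σ i : Fin K.1, Fin (K.2 i).cols) :=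
  (Matrix.blockDiagonal' fun i => (K.2 i).toPencil.1,
   Matrix.blockDiagonal' fun i => (K.2 i).toPencil.2)

/-- Replace every eigenvalue `μ` by `φ μ`, keeping all block sizes. -/
def mapEigenvalue (φ : OnePoint ℂ → OnePoint ℂ) (K : KFamily) : KFamily :=
  ⟨K.1, fun i => (K.2 i).mapEigenvalue φ⟩

/-- The number of Jordan blocks with eigenvalue `μ` and size at least `i` (for `i ≥ 1`). -/
noncomputable def weyrEntry (μ : OnePoint ℂ) (K : KFamily) (i : ℕ) : ℕ :=
  (Finset.univ.filter fun j : Fin K.1 => i ≤ (K.2 j).sizeAt μ).card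

/-- The largest size of a Jordan block with eigenvalue `μ`, and `0` if there is none. -/
noncomputable def maxSizeAt (μ : OnePoint ℂ) (K : KFamily) : ℕ :=
  Finset.univ.sup fun j : Fin K.1 => (K.2 j).sizeAt μ

/-- The list `(W_1, W_2, …, W_N)`, where `W_i` is the number of Jordan blocks with eigenvalue `μ`
and size at least `i`, and `N` is the largest size of such a block (so `W_i = 0` for `i > N`). -/
noncomputable def weyr (μ : OnePoint ℂ) (K : KFamily) : List ℕ :=
  (List.range (maxSizeAt μ K)).map fun i => weyrEntry μ K (i + 1)

end KFamily

namespace Pencil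

variable {m n : ℕ}

/-- `K` is a Kronecker canonical form of `L`: the pencil `L` is strictly equivalent to the block
diagonal pencil with the canonical blocks `K` (`e` and `f` only number its rows and columns; they
exist exactly when the sizes agree). -/
def IsKCF (L : Pencil (Fin m) (Fin n)) (K : KFamily) : Prop :=
  ∃ (e : (Σ i : Fin K.1, Fin (K.2 i).rows) ≃ Fin m)
    (f : (Σ i : Fin K.1, Fin (K.2 i).cols) ≃ Fin n),
    L ∈ orbit (Matrix.reindex e f K.toPencil.1, Matrix.reindex e f K.toPencil.2)

/-- The Kronecker canonical form of a pencil, with its blocks in some order. -/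
noncomputable def kcf (L : Pencil (Fin m) (Fin n)) : KFamily :=
  @Classical.epsilon KFamily ⟨⟨0, Fin.elim0⟩⟩ (IsKCF L)

/-- `μ ∈ ℂ ∪ {∞}` is an eigenvalue of `L`: the canonical form has a Jordan block with
eigenvalue `μ`. -/
def IsEigenvalue (μ : OnePoint ℂ) (L : Pencil (Fin m) (Fin n)) : Prop :=
  ∃ (j : Fin L.kcf.1) (k : ℕ+), L.kcf.2 j = KBlock.jordan μ k

/-- The Weyr characteristic `W(μ, L)`, as a list without trailing zeros. -/
noncomputable def weyr (μ : OnePoint ℂ) (L : Pencil (Fin m) (Fin n)) : List ℕ :=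
  KFamily.weyr μ L.kcf

/-- `L'` is a pencil `φ(L)`: it is strictly equivalent to a canonical form of `L` in which every
eigenvalue `μ` has been replaced by `φ μ`. -/
def IsEigenvalueReplacement (φ : OnePoint ℂ → OnePoint ℂ) (L L' : Pencil (Fin m) (Fin n)) : Prop :=
  ∃ K : KFamily, IsKCF L K ∧ IsKCF L' (K.mapEigenvalue φ)

/-- The bundle of `L`: the union of the orbits of the pencils `φ(L)` over all one-to-one maps `φ`
of `ℂ ∪ {∞}` to itself. -/
def bundle (L : Pencil (Fin m) (Fin n)) : Set (Pencil (Fin m) (Fin n)) :=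
  {M | ∃ φ : OnePoint ℂ → OnePoint ℂ, Function.Injective φ ∧
    ∃ L' : Pencil (Fin m) (Fin n), IsEigenvalueReplacement φ L L' ∧ M ∈ orbit L'}

end Pencil

/-- The union of finitely many lists: all their numbers, arranged in non-increasing order. -/
def listUnion {s : ℕ} (l : Fin s → List ℕ) : List ℕ :=
  (List.ofFn l).flatten.insertionSort (· ≥ ·)

/-- A list continued by zeros (the first entry has index `0`). -/
def listSeq (l : List ℕ) : ℕ → ℤ := fun i => ((l.getD i 0 : ℕ) : ℤ)

/-- `a ≺ b`: for every `j`, the sum of the first `j` entries of `a` is at most that of `b`. -/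
def IsMajorizedBy (a b : ℕ → ℤ) : Prop :=
  ∀ j : ℕ, ∑ i ∈ Finset.range j, a i ≤ ∑ i ∈ Finset.range j, b i

/-!
The partial sums of the Weyr characteristic are kernel dimensions.  For a finite-dimensional
`ℂ`-algebra `S = ℂ[X] / g` and a pencil `L = λ B + A`, consider the `ℂ`-dimension of the kernel of
`t B + A` acting on vectors over `S`, where `t` is the class of `X`.  It is additive over the blocks
of the Kronecker canonical form (`Pencil.IsKCF.finrank_ker_evalMap`): a right singular block
contributes `dim S`, a left singular block nothing, and a Jordan block of size `p` with eigenvalue `ν`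
contributes the kernel of `(t - ν) ^ p` on `S`, of dimension `min p d` if `ν` is a `d`-fold root of
`g`.  The number of right singular blocks is `n - rank L`, by the same computation over `ℂ(λ)`
(`Pencil.IsKCF.rank_add_numRight`).

The `j` largest entries of the union of the `W(λ_i, M_k)` consist of the first `d_i` entries of the
`i`-th list, for some `d_i` with sum at most `j` (`exists_sum_take_listUnion_le`).  Take for `g_k` a
polynomial of degree `j` with the roots `λ_{i,k}`, of multiplicity at least `d_i`, the remaining roots
being `μ`.  Then `j (n - rank L)` plus the sum of these entries is at most the kernel dimension of
`M_k` over `ℂ[X] / g_k`.  In the Newton basis the multiplication by `t` depends continuously on the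
roots, and `g_k` tends to `(X - μ) ^ j`; since kernel dimensions are upper semicontinuous
(`eventually_finrank_ker_le`), the dimension for large `k` is at most that of `M` over
`ℂ[X] / (X - μ) ^ j`, which is at most `j (n - rank M)` plus the sum of the first `j` entries of
`W(μ, M)`.  If `μ = ∞`, the pencil `B + t A` and the coordinate `1 / λ` are used instead
(`AffineChart`).

The canonical form of the limit `M` is known to exist only by Kronecker's theorem
(`Pencil.isKCF_kcf`).  It is proved by splitting off one block at a time: a kernel chain of minimal
length, or a Jordan chain of maximal length, has a dual chain of functionals, since otherwise duality
would produce a shorter kernel chain or a longer Jordan chain; a chain and its dual make a canonical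
block a retract of the pencil (`HasBlockForm.of_retract`).
-/

/-! ### Kernel chains and Jordan chains -/

section Chains

variable {U V : Type*} [AddCommGroup U] [Module ℂ U] [AddCommGroup V] [Module ℂ V]

/-- The coefficients `x 0, …, x ε` of a polynomial vector annihilated by the pencil, up to signs:
`A (x 0) = 0`, `A (x (i + 1)) = B (x i)` and `B (x ε) = 0`, with `x 0 ≠ 0`.  The sequence is
continued by zeros, so that the last relation is the instance `i = ε` of the recursion. -/
def IsKernelChain (A B : U →ₗ[ℂ] V) (x : ℕ → U) (ε : ℕ) : Prop :=
  x 0 ≠ 0 ∧ A (x 0) = 0 ∧ (∀ i, A (x (i + 1)) = B (x i)) ∧ ∀ i, ε < i → x i = 0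

/-- A Jordan chain of length `k` at the eigenvalue `0` of `λ B + A`, up to signs; only the first
`k` terms of the sequence matter. -/
def IsJordanChain (A B : U →ₗ[ℂ] V) (x : ℕ → U) (k : ℕ) : Prop :=
  x 0 ≠ 0 ∧ A (x 0) = 0 ∧ ∀ i, i + 1 < k → A (x (i + 1)) = B (x i)

/-- The last nonzero term of a kernel chain is annihilated by `B`. -/
theorem not_isKernelChain_of_injective {A B : U →ₗ[ℂ] V} (hB : Function.Injective B) {x : ℕ → U}
    {ε : ℕ} : ¬ IsKernelChain A B x ε := by
  induction ε with
  | zero =>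
    rintro ⟨h0, -, h, hz⟩
    refine h0 (hB ?_)
    rw [← h 0, hz 1 (by simp), map_zero, map_zero]
  | succ ε ih =>
    rintro ⟨h0, hA, h, hz⟩
    refine ih ⟨h0, hA, h, fun i hi => ?_⟩
    rcases Nat.lt_or_ge (ε + 1) i with h1 | h1
    · exact hz i h1
    · obtain rfl : i = ε + 1 := by omega
      refine hB ?_
      rw [← h, hz (ε + 1 + 1) (by simp), map_zero, map_zero]

/-- The action of `A - X B` on polynomials with coefficients in `U`, encoded as finitely supported
sequences. -/
noncomputable def shiftMap (A B : U →ₗ[ℂ] V) : (ℕ →₀ U) →ₗ[ℂ] (ℕ →₀ V) :=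
  Finsupp.mapRange.linearMap A -
    Finsupp.lmapDomain V ℂ Nat.succ ∘ₗ Finsupp.mapRange.linearMap B

theorem shiftMap_zero (A B : U →ₗ[ℂ] V) (u : ℕ →₀ U) : shiftMap A B u 0 = A (u 0) := by
  simp [shiftMap, Finsupp.mapDomain_of_notMem_range]

theorem shiftMap_succ (A B : U →ₗ[ℂ] V) (u : ℕ →₀ U) (i : ℕ) :
    shiftMap A B u (i + 1) = A (u (i + 1)) - B (u i) := by
  have := Finsupp.mapDomain_apply (f := Nat.succ) Nat.succ_injective
    (Finsupp.mapRange B (map_zero B) u) i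
  simp only [Nat.succ_eq_add_one] at this
  simp [shiftMap, this]

theorem shiftMap_single (A B : U →ₗ[ℂ] V) (u : U) (i : ℕ) :
    shiftMap A B (Finsupp.single i u) =
      Finsupp.single i (A u) - Finsupp.single (i + 1) (B u) := by
  simp [shiftMap, Finsupp.mapDomain_single]

/-- A kernel chain of minimal length has a dual chain of functionals.  If no functional separated
`B (x 0)` from the image of shorter chains, a solution of the resulting equations would give a
shorter kernel chain starting at `x 0`. -/
theorem IsKernelChain.exists_dual {A B : U →ₗ[ℂ] V} {x : ℕ → U} {e : ℕ}
    (hx : IsKernelChain A B x (e + 1)) (hmin : ∀ z, ¬ IsKernelChain A B z e) :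
    ∃ g : ℕ → Module.Dual ℂ V, (∀ i < e, ∀ u, g i (A u) = g (i + 1) (B u)) ∧
      g 0 (B (x 0)) ≠ 0 := by
  obtain ⟨h0, hA, h, hz⟩ := hx
  have hmem : Finsupp.single 0 (B (x 0)) ∉
      (Finsupp.supported U ℂ {i | i < e}).map (shiftMap A B) := by
    rintro ⟨u, hu, hu'⟩
    rw [SetLike.mem_coe, Finsupp.mem_supported'] at hu
    refine hmin (fun i => Nat.casesOn i (x 0) u) ⟨h0, hA, fun i => ?_, fun i hi => ?_⟩
    · cases i with
      | zero =>
        have := DFunLike.congr_fun hu' 0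
        simpa [shiftMap_zero] using this
      | succ i =>
        have := DFunLike.congr_fun hu' (i + 1)
        rw [shiftMap_succ] at this
        simpa [sub_eq_zero] using this
    · cases i with
      | zero => simp at hi
      | succ i => exact hu i (by simpa using hi)
  obtain ⟨G, hG, hle⟩ := Submodule.exists_le_ker_of_notMem hmem
  refine ⟨fun i => G ∘ₗ Finsupp.lsingle i, fun i hi u => ?_, hG⟩
  have hk : shiftMap A B (Finsupp.single i u) ∈ LinearMap.ker G :=
    hle ⟨_, Finsupp.single_mem_supported ℂ u hi, rfl⟩
  rw [LinearMap.mem_ker, shiftMap_single, map_sub, sub_eq_zero] at hk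
  exact hk

/-- A Jordan chain that cannot be replaced by a longer one has a dual chain of functionals. -/
theorem IsJordanChain.exists_dual {A B : U →ₗ[ℂ] V} {x : ℕ → U} {k : ℕ}
    (hx : IsJordanChain A B x k) (hmax : ∀ z, ¬ IsJordanChain A B z (k + 1)) :
    ∃ g : ℕ → Module.Dual ℂ V, (∀ i u, g i (A u) = g (i + 1) (B u)) ∧
      (∀ i, k ≤ i → g i = 0) ∧ g 0 (B (x 0)) ≠ 0 := by
  obtain ⟨h0, hA, -⟩ := hx
  have hmem : Finsupp.single 0 (B (x 0)) ∉
      LinearMap.range (shiftMap A B) ⊔ Finsupp.supported V ℂ {i | k ≤ i} := by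
    intro hm
    obtain ⟨_, ⟨u, rfl⟩, w, hw, hsum⟩ := Submodule.mem_sup.1 hm
    rw [Finsupp.mem_supported'] at hw
    refine hmax (fun i => Nat.casesOn i (x 0) u) ⟨h0, hA, fun i hi => ?_⟩
    have hwi : w i = 0 := hw i (by simpa using hi)
    cases i with
    | zero =>
      have := DFunLike.congr_fun hsum 0
      simpa [shiftMap_zero, hwi] using this
    | succ i =>
      have := DFunLike.congr_fun hsum (i + 1)
      rw [Finsupp.add_apply, shiftMap_succ, hwi] at this
      simpa [sub_eq_zero] using this
  obtain ⟨G, hG, hle⟩ := Submodule.exists_le_ker_of_notMem hmem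
  refine ⟨fun i => G ∘ₗ Finsupp.lsingle i, fun i u => ?_, fun i hi => ?_, hG⟩
  · have hk : shiftMap A B (Finsupp.single i u) ∈ LinearMap.ker G :=
      hle (Submodule.mem_sup_left ⟨_, rfl⟩)
    rw [LinearMap.mem_ker, shiftMap_single, map_sub, sub_eq_zero] at hk
    exact hk
  · ext v
    exact hle (Submodule.mem_sup_right (Finsupp.single_mem_supported ℂ v hi))

/-- Without kernel chains, the terms of a Jordan chain are linearly independent, so the length is
bounded: the convolution of a linear relation with the chain would be a kernel chain. -/
theorem IsJordanChain.length_le [FiniteDimensional ℂ U] {A B : U →ₗ[ℂ] V} {x : ℕ → U} {k : ℕ}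
    (hx : IsJordanChain A B x k) (hker : ∀ z ε, ¬ IsKernelChain A B z ε) :
    k ≤ Module.finrank ℂ U := by
  by_contra! hlt
  obtain ⟨h0, hA, h⟩ := hx
  have hdep : ¬ LinearIndependent ℂ fun i : Fin k => x i := fun hli => by
    have := hli.fintype_card_le_finrank
    simp at this
    omega
  rw [Fintype.not_linearIndependent_iff] at hdep
  obtain ⟨c, hc, i₀, hi₀⟩ := hdep
  -- `d` lists the coefficients of the relation downwards from the last nonzero one
  let C : ℕ → ℂ := fun i => if hi : i < k then c ⟨i, hi⟩ else 0
  have hCsum : ∑ i ∈ Finset.range k, C i • x i = 0 := by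
    rw [← hc, ← Fin.sum_univ_eq_sum_range (fun i => C i • x i)]
    simp [C]
  have hCne : ∃ r, r ≤ k ∧ C r ≠ 0 := ⟨i₀, i₀.2.le, by simpa [C] using hi₀⟩
  classical
  set r := Nat.findGreatest (fun r => C r ≠ 0) k with hr
  obtain ⟨r', hr'k, hr'⟩ := hCne
  have hCr : C r ≠ 0 := Nat.findGreatest_spec (P := fun r => C r ≠ 0) hr'k hr'
  have hCgt : ∀ i, r < i → C i = 0 := by
    intro i hi
    by_cases hik : i ≤ k
    · by_contra hne
      exact absurd (Nat.le_findGreatest (P := fun r => C r ≠ 0) hik hne) (by omega)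
    · simp [C, show ¬ i < k by omega]
  have hrk : r < k := by
    by_contra hge
    exact hCr (by simp [C, hge])
  let y : ℕ → U := fun j => ∑ p ∈ Finset.HasAntidiagonal.antidiagonal j, C (r - p.1) • x p.2
  have hy0 : y 0 = C r • x 0 := by simp [y]
  have hyr : y r = 0 := by
    have h1 : y r = ∑ i ∈ Finset.range (r + 1), C i • x i := by
      simp only [y]
      rw [Finset.Nat.sum_antidiagonal_eq_sum_range_succ (fun a b => C (r - a) • x b),
        ← Finset.sum_range_reflect]
      refine Finset.sum_congr rfl fun i hi => ?_
      rw [Finset.mem_range] at hi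
      congr 2 <;> omega
    rw [h1, ← hCsum]
    refine Finset.sum_subset (fun i hi => ?_) fun i _ hi => ?_
    · simp only [Finset.mem_range] at *; omega
    · rw [hCgt i (by simp only [Finset.mem_range] at *; omega), zero_smul]
  have hyA : ∀ j, j + 1 ≤ r → A (y (j + 1)) = B (y j) := by
    intro j hj
    simp only [y]
    rw [Finset.Nat.sum_antidiagonal_succ']
    simp only [map_add, map_smul, hA, smul_zero, zero_add, map_sum]
    refine Finset.sum_congr rfl fun p hp => ?_
    rw [Finset.HasAntidiagonal.mem_antidiagonal] at hp
    rw [h p.2 (by omega)]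
  have hrpos : r ≠ 0 := by
    intro hr0
    rw [hr0] at hyr hCr
    rw [hy0, hr0] at hyr
    exact (smul_ne_zero hCr h0) hyr
  refine hker (fun j => if j < r then y j else 0) r ⟨?_, ?_, fun i => ?_, fun i hi => ?_⟩
    <;> beta_reduce
  · rw [if_pos (by omega), hy0]; exact smul_ne_zero hCr h0
  · rw [if_pos (by omega), hy0, map_smul, hA, smul_zero]
  · rcases lt_trichotomy (i + 1) r with h1 | h1 | h1
    · rw [if_pos h1, if_pos (by omega)]; exact hyA i h1.le
    · rw [if_neg (by omega), if_pos (by omega), map_zero, ← hyA i h1.le, h1, hyr, map_zero]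
    · rw [if_neg (by omega), if_neg (by omega), map_zero, map_zero]
  · rw [if_neg (by omega)]

/-- Counting dimensions in the equations for a kernel chain of large length. -/
theorem exists_isKernelChain_of_finrank_lt [FiniteDimensional ℂ U] [FiniteDimensional ℂ V]
    (A B : U →ₗ[ℂ] V) (hlt : Module.finrank ℂ V < Module.finrank ℂ U) :
    ∃ x ε, IsKernelChain A B x ε := by
  set k := Module.finrank ℂ V + 1 with hk
  let ext : (Fin k → U) →ₗ[ℂ] (ℕ → U) := LinearMap.pi fun i =>
    if hi : i < k then LinearMap.proj ⟨i, hi⟩ else 0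
  let D : (Fin k → U) →ₗ[ℂ] (Fin (k + 1) → V) := LinearMap.pi fun i =>
    A ∘ₗ LinearMap.proj (i : ℕ) ∘ₗ ext -
      Nat.casesOn (i : ℕ) 0 fun j => B ∘ₗ LinearMap.proj j ∘ₗ ext
  have hD : LinearMap.ker D ≠ ⊥ := by
    apply LinearMap.ker_ne_bot_of_finrank_lt
    simp only [Module.finrank_pi_fintype, Finset.sum_const, Finset.card_univ, Fintype.card_fin,
      smul_eq_mul]
    nlinarith
  obtain ⟨u, hu, hu0⟩ := Submodule.exists_mem_ne_zero_of_ne_bot hD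
  let X : ℕ → U := ext u
  have hXge : ∀ i, k ≤ i → X i = 0 := fun i hi => by
    simp [X, ext, show ¬ i < k by omega]
  have hX0 : A (X 0) = 0 := by
    have := congrFun (LinearMap.mem_ker.1 hu) 0
    simpa [D] using this
  have hXs : ∀ i, A (X (i + 1)) = B (X i) := by
    intro i
    by_cases hi : i + 1 < k + 1
    · have := congrFun (LinearMap.mem_ker.1 hu) ⟨i + 1, hi⟩
      simpa [D, sub_eq_zero] using this
    · rw [hXge _ (by omega), hXge _ (by omega), map_zero, map_zero]
  have hne : ∃ i, X i ≠ 0 := by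
    by_contra! hall
    refine hu0 (funext fun i => ?_)
    have := hall i
    simpa [X, ext] using this
  classical
  refine ⟨fun i => X (i + Nat.find hne), k, by simpa using Nat.find_spec hne, ?_,
    fun i => ?_, fun i hi => hXge _ (by omega)⟩
  · rcases hm : Nat.find hne with _ | m
    · simpa using hX0
    · have : X m = 0 := by
        have := Nat.find_min hne (m := m) (by omega)
        simpa using this
      show A (X (0 + (m + 1))) = 0
      rw [zero_add, hXs, this, map_zero]
  · show A (X (i + 1 + _)) = _
    rw [add_right_comm, hXs]

end Chains

/-! ### Action of the canonical blocks on vectors -/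

section BlockAction

open Matrix

variable {S : Type*} [CommRing S] (φ : ℂ →+* S) {k : ℕ}

theorem superdiag_mulVec_castSucc (c : Fin (k + 1) → S) (i : Fin k) :
    ((superdiag (k + 1)).map φ *ᵥ c) i.castSucc = c i.succ := by
  rw [Matrix.mulVec, dotProduct, Finset.sum_eq_single i.succ]
  · simp [superdiag]
  · intro j _ hj
    have : ¬ (j : ℕ) = i + 1 := fun h => hj (Fin.ext (by simpa using h))
    simp [superdiag, this]
  · simp

theorem superdiag_mulVec_last (c : Fin (k + 1) → S) :
    ((superdiag (k + 1)).map φ *ᵥ c) (Fin.last k) = 0 := by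
  rw [Matrix.mulVec, dotProduct]
  refine Finset.sum_eq_zero fun j _ => ?_
  have : ¬ (j : ℕ) = k + 1 := by omega
  simp [superdiag, this]

theorem rightSingular_fst_mulVec (c : Fin (k + 1) → S) (i : Fin k) :
    ((rightSingular k).1.map φ *ᵥ c) i = c i.castSucc := by
  rw [Matrix.mulVec, dotProduct, Finset.sum_eq_single i.castSucc]
  · simp [rightSingular]
  · intro j _ hj
    have : ¬ (j : ℕ) = i := fun h => hj (Fin.ext (by simpa using h))
    simp [rightSingular, this]
  · simp

theorem rightSingular_snd_mulVec (c : Fin (k + 1) → S) (i : Fin k) :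
    ((rightSingular k).2.map φ *ᵥ c) i = c i.succ := by
  rw [Matrix.mulVec, dotProduct, Finset.sum_eq_single i.succ]
  · simp [rightSingular]
  · intro j _ hj
    have : ¬ (j : ℕ) = i + 1 := fun h => hj (Fin.ext (by simpa using h))
    simp [rightSingular, this]
  · simp

theorem rightSingular_fst_transpose_mulVec_castSucc (c : Fin k → S) (i : Fin k) :
    ((rightSingular k).1ᵀ.map φ *ᵥ c) i.castSucc = c i := by
  rw [Matrix.mulVec, dotProduct, Finset.sum_eq_single i]
  · simp [rightSingular]
  · intro j _ hj
    have : ¬ (i : ℕ) = j := fun h => hj (Fin.ext (by simpa using h.symm))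
    simp [rightSingular, this]
  · simp

theorem rightSingular_fst_transpose_mulVec_last (c : Fin k → S) :
    ((rightSingular k).1ᵀ.map φ *ᵥ c) (Fin.last k) = 0 := by
  rw [Matrix.mulVec, dotProduct]
  refine Finset.sum_eq_zero fun j _ => ?_
  have : ¬ k = (j : ℕ) := by omega
  simp [rightSingular, this]

theorem rightSingular_snd_transpose_mulVec_succ (c : Fin k → S) (i : Fin k) :
    ((rightSingular k).2ᵀ.map φ *ᵥ c) i.succ = c i := by
  rw [Matrix.mulVec, dotProduct, Finset.sum_eq_single i]
  · simp [rightSingular]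
  · intro j _ hj
    have : ¬ (i : ℕ) = j := fun h => hj (Fin.ext (by simpa using h.symm))
    simp [rightSingular, this]
  · simp

theorem rightSingular_snd_transpose_mulVec_zero (c : Fin k → S) :
    ((rightSingular k).2ᵀ.map φ *ᵥ c) 0 = 0 := by
  rw [Matrix.mulVec, dotProduct]
  refine Finset.sum_eq_zero fun j _ => ?_
  simp [rightSingular]

end BlockAction

/-! ### Splitting off a canonical block -/

section BlockForm

open Matrix

variable {U V : Type*} [AddCommGroup U] [Module ℂ U] [AddCommGroup V] [Module ℂ V]

/-- In suitable bases of `U` and `V`, the pencil `λ B + A` of linear maps is the direct sum of the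
canonical blocks `K`. -/
def HasBlockForm (B A : U →ₗ[ℂ] V) (K : KFamily) : Prop :=
  ∃ (eU : U ≃ₗ[ℂ] ((i : Fin K.1) → Fin (K.2 i).cols → ℂ))
    (eV : V ≃ₗ[ℂ] ((i : Fin K.1) → Fin (K.2 i).rows → ℂ)),
    ∀ u i, eV (B u) i = (K.2 i).toPencil.1 *ᵥ eU u i ∧ eV (A u) i = (K.2 i).toPencil.2 *ᵥ eU u i

/-- The splitting of a space off along a section `x` of `f`. -/
noncomputable def splitEquiv {E : Type*} [AddCommGroup E] [Module ℂ E] (f : U →ₗ[ℂ] E)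
    (x : E →ₗ[ℂ] U) (h : ∀ c, f (x c) = c) : U ≃ₗ[ℂ] E × LinearMap.ker f where
  toFun u := (f u, ⟨u - x (f u), by simp [h]⟩)
  map_add' u v := by
    ext
    · simp
    · simp; abel
  map_smul' c u := by
    ext
    · simp
    · simp [smul_sub]
  invFun p := x p.1 + p.2
  left_inv u := by simp
  right_inv p := by
    obtain ⟨e, u, hu⟩ := p
    rw [LinearMap.mem_ker] at hu
    ext
    · simp [h, hu]
    · simp [h, hu]

/-- If a canonical block `b` is a retract of the pencil `λ B + A`, it can be split off. -/
theorem HasBlockForm.of_section {B A : U →ₗ[ℂ] V} (b : KBlock)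
    (f : U →ₗ[ℂ] (Fin b.cols → ℂ)) (g : V →ₗ[ℂ] (Fin b.rows → ℂ))
    (x : (Fin b.cols → ℂ) →ₗ[ℂ] U) (y : (Fin b.rows → ℂ) →ₗ[ℂ] V)
    (hfB : ∀ u, g (B u) = b.toPencil.1 *ᵥ f u) (hfA : ∀ u, g (A u) = b.toPencil.2 *ᵥ f u)
    (hxB : ∀ c, B (x c) = y (b.toPencil.1 *ᵥ c)) (hxA : ∀ c, A (x c) = y (b.toPencil.2 *ᵥ c))
    (hfx : ∀ c, f (x c) = c) (hgy : ∀ c, g (y c) = c)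
    {B' A' : LinearMap.ker f →ₗ[ℂ] LinearMap.ker g} (hB' : ∀ u, (B' u : V) = B u)
    (hA' : ∀ u, (A' u : V) = A u) {K : KFamily} (hK : HasBlockForm B' A' K) :
    ∃ K', HasBlockForm B A K' := by
  obtain ⟨eU, eV, h⟩ := hK
  let K' : KFamily := ⟨K.1 + 1, Fin.cons b K.2⟩
  let cU := Fin.consLinearEquiv ℂ fun i : Fin (K.1 + 1) => Fin (K'.2 i).cols → ℂ
  let cV := Fin.consLinearEquiv ℂ fun i : Fin (K.1 + 1) => Fin (K'.2 i).rows → ℂ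
  refine ⟨K', (splitEquiv f x hfx).trans (((LinearEquiv.refl ℂ _).prodCongr eU).trans cU),
    (splitEquiv g y hgy).trans (((LinearEquiv.refl ℂ _).prodCongr eV).trans cV), fun u i => ?_⟩
  have hBk : B u - y (g (B u)) = B' ⟨u - x (f u), by simp [hfx]⟩ := by
    rw [hB', hfB, ← hxB]; simp
  have hAk : A u - y (g (A u)) = A' ⟨u - x (f u), by simp [hfx]⟩ := by
    rw [hA', hfA, ← hxA]; simp
  refine Fin.cases ?_ (fun i => ?_) i
  · exact ⟨hfB u, hfA u⟩
  · have h' := h ⟨u - x (f u), by simp [hfx]⟩ i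
    refine ⟨Eq.trans ?_ h'.1, Eq.trans ?_ h'.2⟩
    · exact congrFun (congrArg eV (Subtype.ext hBk)) i
    · exact congrFun (congrArg eV (Subtype.ext hAk)) i

/-- In a retraction onto the canonical block `b`, the maps `x` and `y` need only be sections of `f`
and `g` up to automorphisms of `ℂ^cols` and `ℂ^rows`; these are then automorphisms of the block. -/
theorem HasBlockForm.of_retract {B A : U →ₗ[ℂ] V} (b : KBlock)
    (f : U →ₗ[ℂ] (Fin b.cols → ℂ)) (g : V →ₗ[ℂ] (Fin b.rows → ℂ))
    (x : (Fin b.cols → ℂ) →ₗ[ℂ] U) (y : (Fin b.rows → ℂ) →ₗ[ℂ] V)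
    (hfB : ∀ u, g (B u) = b.toPencil.1 *ᵥ f u) (hfA : ∀ u, g (A u) = b.toPencil.2 *ᵥ f u)
    (hxB : ∀ c, B (x c) = y (b.toPencil.1 *ᵥ c)) (hxA : ∀ c, A (x c) = y (b.toPencil.2 *ᵥ c))
    (hfx : Function.Injective (f ∘ₗ x)) (hgy : Function.Injective (g ∘ₗ y))
    (ih : ∀ (B' A' : LinearMap.ker f →ₗ[ℂ] LinearMap.ker g), Function.Surjective f →
      Function.Surjective g → ∃ K, HasBlockForm B' A' K) :
    ∃ K, HasBlockForm B A K := by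
  let α := LinearEquiv.ofInjectiveEndo _ hfx
  let β := LinearEquiv.ofInjectiveEndo _ hgy
  have hα : ∀ c, f (x (α.symm c)) = c := α.apply_symm_apply
  have hβ : ∀ c, g (y (β.symm c)) = c := β.apply_symm_apply
  have hmem : ∀ (T : U →ₗ[ℂ] V) (N : Matrix (Fin b.rows) (Fin b.cols) ℂ)
      (_ : ∀ u, g (T u) = N *ᵥ f u) (u : LinearMap.ker f), T u ∈ LinearMap.ker g := by
    intro T N hT u
    rw [LinearMap.mem_ker, hT, LinearMap.mem_ker.1 u.2, Matrix.mulVec_zero]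
  have hinter : ∀ (T : U →ₗ[ℂ] V) (N : Matrix (Fin b.rows) (Fin b.cols) ℂ)
      (_ : ∀ u, g (T u) = N *ᵥ f u) (_ : ∀ c, T (x c) = y (N *ᵥ c)) (c : Fin b.cols → ℂ),
      T (x (α.symm c)) = y (β.symm (N *ᵥ c)) := by
    intro T N h1 h2 c
    have : N *ᵥ α.symm c = β.symm (N *ᵥ c) := by
      rw [LinearEquiv.eq_symm_apply]
      show g (y _) = _
      rw [← h2, h1, hα]
    rw [h2, this]
  obtain ⟨K, hK⟩ := ih ((B ∘ₗ Submodule.subtype _).codRestrict _ (hmem B _ hfB))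
    ((A ∘ₗ Submodule.subtype _).codRestrict _ (hmem A _ hfA)) (fun c => ⟨_, hα c⟩)
    fun c => ⟨_, hβ c⟩
  exact HasBlockForm.of_section b f g (x ∘ₗ α.symm.toLinearMap) (y ∘ₗ β.symm.toLinearMap) hfB hfA
    (hinter B _ hfB hxB) (hinter A _ hfA hxA) hα hβ (fun _ => rfl) (fun _ => rfl) hK

end BlockForm

/-! ### Kronecker's theorem -/

section Kronecker

open Matrix

variable {U V : Type*} [AddCommGroup U] [Module ℂ U] [AddCommGroup V] [Module ℂ V]

/-- A triangular pairing with nonzero diagonal is nondegenerate. -/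
theorem injective_pi_comp_linearCombination {n : ℕ} (f : Fin n → Module.Dual ℂ U) (x : Fin n → U)
    (h : (∀ i j, j < i → f i (x j) = 0) ∨ ∀ i j, i < j → f i (x j) = 0)
    (hd : ∀ i, f i (x i) ≠ 0) :
    Function.Injective (LinearMap.pi f ∘ₗ Fintype.linearCombination ℂ x) := by
  have hM : (LinearMap.pi f ∘ₗ Fintype.linearCombination ℂ x) =
      (Matrix.of fun i j => f i (x j)).mulVecLin := by
    refine LinearMap.ext fun c => funext fun i => ?_
    simp [Fintype.linearCombination_apply, Matrix.mulVec, dotProduct, mul_comm]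
  have hdet : (Matrix.of fun i j => f i (x j)).det ≠ 0 := by
    rcases h with h | h
    · rw [Matrix.det_of_isUpperTriangular (M := Matrix.of fun i j => f i (x j)) fun i j hij => h i j hij]
      exact Finset.prod_ne_zero_iff.2 fun i _ => hd i
    · rw [Matrix.det_of_isLowerTriangular (Matrix.of fun i j => f i (x j)) fun i j hij => h i j hij]
      exact Finset.prod_ne_zero_iff.2 fun i _ => hd i
  rw [hM]
  exact Matrix.mulVec_injective_iff_isUnit.2
    ((Matrix.isUnit_iff_isUnit_det _).2 (isUnit_iff_ne_zero.2 hdet))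

/-- The dual chain of a minimal kernel chain, completed to functionals on both spaces that project
the pencil onto a right singular block. -/
theorem IsKernelChain.exists_retract {A B : U →ₗ[ℂ] V} {x : ℕ → U} {ε : ℕ}
    (hx : IsKernelChain A B x ε) (hmin : ∀ z, ∀ e < ε, ¬ IsKernelChain A B z e) :
    ∃ (f : Fin (ε + 1) → Module.Dual ℂ U) (g : Fin ε → Module.Dual ℂ V),
      (∀ i u, g i (B u) = f i.castSucc u) ∧ (∀ i u, g i (A u) = f i.succ u) ∧
      (∀ i j, j < i → f i (x j) = 0) ∧ ∀ i, f i (x i) ≠ 0 := by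
  cases ε with
  | zero =>
    obtain ⟨φ, hφ⟩ := Module.Projective.exists_dual_ne_zero ℂ hx.1
    refine ⟨fun _ => φ, Fin.elim0, fun i => i.elim0, fun i => i.elim0, fun i j hij => ?_,
      fun i => ?_⟩
    · omega
    · simpa using hφ
  | succ e =>
    obtain ⟨g, hg, hg0⟩ := hx.exists_dual fun z => hmin z e (by simp)
    obtain ⟨-, hA, h, -⟩ := hx
    have hlow : ∀ i ≤ e, ∀ j < i, g i (B (x j)) = 0 := by
      intro i
      induction i with
      | zero => intro _ j hj; omega
      | succ i ih =>
        intro hi j hj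
        rw [← hg i (by omega)]
        cases j with
        | zero => rw [hA, map_zero]
        | succ j => rw [h]; exact ih (by omega) j (by omega)
    have hdiag : ∀ i ≤ e, g i (B (x i)) = g 0 (B (x 0)) := by
      intro i
      induction i with
      | zero => intro _; rfl
      | succ i ih => intro hi; rw [← hg i (by omega), h]; exact ih (by omega)
    refine ⟨fun i => if (i : ℕ) ≤ e then g i ∘ₗ B else g e ∘ₗ A, fun i => g i, fun i u => ?_,
      fun i u => ?_, fun i j hij => ?_, fun i => ?_⟩
    · have : (i : ℕ) ≤ e := by omega
      simp [this]
    · by_cases hi : (i : ℕ) + 1 ≤ e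
      · simp [hi, hg i (by omega)]
      · obtain hi' : (i : ℕ) = e := by omega
        simp [hi']
    · dsimp only
      rw [Fin.lt_def] at hij
      split_ifs with hi
      · exact hlow i hi j hij
      · rcases hj : (j : ℕ) with _ | j'
        · simp [hA]
        · rw [LinearMap.comp_apply, h]; exact hlow e le_rfl j' (by omega)
    · dsimp only
      split_ifs with hi
      · rw [LinearMap.comp_apply, hdiag i hi]; exact hg0
      · obtain hi' : (i : ℕ) = e + 1 := by omega
        rw [hi', LinearMap.comp_apply, h, hdiag e le_rfl]; exact hg0

/-- A Jordan chain of maximal length spans a retract of the pencil, isomorphic to a nilpotent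
Jordan block. -/
theorem IsJordanChain.exists_retract {A B : U →ₗ[ℂ] V} {x : ℕ → U} {k : ℕ}
    (hx : IsJordanChain A B x (k + 1)) (hmax : ∀ z, ¬ IsJordanChain A B z (k + 2)) :
    ∃ (f : U →ₗ[ℂ] (Fin (k + 1) → ℂ)) (g : V →ₗ[ℂ] (Fin (k + 1) → ℂ))
      (ξ : (Fin (k + 1) → ℂ) →ₗ[ℂ] U) (η : (Fin (k + 1) → ℂ) →ₗ[ℂ] V),
      (∀ u, g (B u) = f u) ∧ (∀ u, g (A u) = superdiag (k + 1) *ᵥ f u) ∧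
      (∀ c, B (ξ c) = η c) ∧ (∀ c, A (ξ c) = η (superdiag (k + 1) *ᵥ c)) ∧
      Function.Injective (f ∘ₗ ξ) ∧ Function.Injective (g ∘ₗ η) := by
  obtain ⟨g, hg, hgk, hg0⟩ := hx.exists_dual hmax
  obtain ⟨-, hA, h⟩ := hx
  have hlow : ∀ i, i ≤ k → ∀ j < i, g i (B (x j)) = 0 := by
    intro i
    induction i with
    | zero => intro _ j hj; omega
    | succ i ih =>
      intro hi j hj
      rw [← hg i]
      cases j with
      | zero => rw [hA, map_zero]
      | succ j => rw [h j (by omega)]; exact ih (by omega) j (by omega)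
  have hdiag : ∀ i ≤ k, g i (B (x i)) = g 0 (B (x 0)) := by
    intro i
    induction i with
    | zero => intro _; rfl
    | succ i ih => intro hi; rw [← hg i, h i (by omega)]; exact ih (by omega)
  have hN : ∀ (c : Fin (k + 1) → ℂ) (i : Fin k), (superdiag (k + 1) *ᵥ c) i.castSucc = c i.succ :=
    fun c i => by simpa using superdiag_mulVec_castSucc (RingHom.id ℂ) c i
  have hN' : ∀ (c : Fin (k + 1) → ℂ), (superdiag (k + 1) *ᵥ c) (Fin.last k) = 0 :=
    fun c => by simpa using superdiag_mulVec_last (RingHom.id ℂ) c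
  have hlow' : ∀ i j : Fin (k + 1), j < i → g i (B (x j)) = 0 := fun i j hij =>
    hlow i (by omega) j hij
  have hdiag' : ∀ i : Fin (k + 1), g i (B (x i)) ≠ 0 := fun i => by
    rw [hdiag i (by omega)]; exact hg0
  refine ⟨LinearMap.pi fun i => g i ∘ₗ B, LinearMap.pi fun i => g i,
    Fintype.linearCombination ℂ fun i => x i, Fintype.linearCombination ℂ fun i => B (x i),
    fun u => rfl, fun u => funext fun i => ?_, fun c => ?_, fun c => ?_,
    injective_pi_comp_linearCombination _ _ (Or.inl hlow') hdiag',
    injective_pi_comp_linearCombination _ _ (Or.inl hlow') hdiag'⟩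
  · refine Fin.lastCases ?_ (fun i => ?_) i
    · rw [hN']
      simp [hg k, hgk (k + 1) le_rfl]
    · rw [hN]
      simp [hg i]
  · simp [Fintype.linearCombination_apply]
  · simp only [Fintype.linearCombination_apply, map_sum, map_smul]
    rw [Fin.sum_univ_succ, Fin.sum_univ_castSucc (n := k), hN']
    simp only [hN]
    simp only [Fin.val_zero, hA, smul_zero, zero_add, zero_smul, add_zero, Fin.val_succ,
      Fin.val_castSucc]
    exact Finset.sum_congr rfl fun i _ => by rw [h i (by omega)]

/-- Splitting a right singular block off a pencil with a kernel chain. -/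
theorem HasBlockForm.of_isKernelChain {A B : U →ₗ[ℂ] V} (hc : ∃ ε z, IsKernelChain A B z ε)
    (ih : ∀ (U' : Submodule ℂ U) (V' : Submodule ℂ V) (B' A' : U' →ₗ[ℂ] V'), U' ≠ ⊤ →
      ∃ K, HasBlockForm B' A' K) :
    ∃ K, HasBlockForm B A K := by
  classical
  obtain ⟨x, hx⟩ := Nat.find_spec hc
  set ε := Nat.find hc with hε
  obtain ⟨f, g, hfB, hfA, hlow, hdiag⟩ := hx.exists_retract fun z e he hz =>
    Nat.find_min hc he ⟨z, hz⟩
  obtain ⟨hx0, hA, h, hz⟩ := hx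
  have h1 := fun (c : Fin (ε + 1) → ℂ) i => rightSingular_fst_mulVec (RingHom.id ℂ) c i
  have h2 := fun (c : Fin (ε + 1) → ℂ) i => rightSingular_snd_mulVec (RingHom.id ℂ) c i
  simp only [RingHom.coe_id, Matrix.map_id] at h1 h2
  have hl : B (x ε) = 0 := by rw [← h, hz (ε + 1) (by omega), map_zero]
  let ξ := Fintype.linearCombination ℂ fun i : Fin (ε + 1) => x i
  let η := Fintype.linearCombination ℂ fun i : Fin ε => B (x i)
  have hBξ : ∀ c, B (ξ c) = η ((rightSingular ε).1 *ᵥ c) := fun c => by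
    simp only [ξ, η, Fintype.linearCombination_apply, map_sum, map_smul, h1]
    rw [Fin.sum_univ_castSucc]
    simp [hl]
  have hAξ : ∀ c, A (ξ c) = η ((rightSingular ε).2 *ᵥ c) := fun c => by
    simp only [ξ, η, Fintype.linearCombination_apply, map_sum, map_smul, h2]
    rw [Fin.sum_univ_succ]
    simp [hA, h]
  refine HasBlockForm.of_retract (KBlock.right ε) (LinearMap.pi f) (LinearMap.pi g) ξ η
    (fun u => funext fun i => (hfB i u).trans (h1 (fun j => f j u) i).symm)
    (fun u => funext fun i => (hfA i u).trans (h2 (fun j => f j u) i).symm) hBξ hAξ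
    (injective_pi_comp_linearCombination _ _ (Or.inl hlow) hdiag)
    (injective_pi_comp_linearCombination _ _ (Or.inl fun i j hij => ?_) fun i => ?_)
    fun B' A' _ _ => ih _ _ B' A' fun htop => ?_
  · rw [hfB]; exact hlow i.castSucc j.castSucc hij
  · rw [hfB]; exact hdiag i.castSucc
  · have h0 : LinearMap.pi f (x 0) = 0 := htop.ge (Submodule.mem_top : x 0 ∈ ⊤)
    exact hdiag 0 (congrFun h0 (0 : Fin (ε + 1)))

/-- Splitting a left singular block off a pencil whose dual pencil has a kernel chain. -/
theorem HasBlockForm.of_isKernelChain_dual [FiniteDimensional ℂ U] [FiniteDimensional ℂ V]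
    {A B : U →ₗ[ℂ] V}
    (hc : ∃ ε z, IsKernelChain A.dualMap B.dualMap z ε)
    (ih : ∀ (U' : Submodule ℂ U) (V' : Submodule ℂ V) (B' A' : U' →ₗ[ℂ] V'), V' ≠ ⊤ →
      ∃ K, HasBlockForm B' A' K) :
    ∃ K, HasBlockForm B A K := by
  classical
  obtain ⟨x, hx⟩ := Nat.find_spec hc
  set ε := Nat.find hc with hε
  obtain ⟨f, g, hfB, hfA, hlow, hdiag⟩ := hx.exists_retract fun z e he hz =>
    Nat.find_min hc he ⟨z, hz⟩
  obtain ⟨hx0, hA, h, hz⟩ := hx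
  -- by reflexivity the functionals on the dual spaces are evaluations at vectors
  obtain ⟨v, hv⟩ : ∃ v : Fin (ε + 1) → V, ∀ i φ, f i φ = φ (v i) :=
    ⟨fun i => (Module.evalEquiv ℂ V).symm (f i), fun i φ => by simp⟩
  obtain ⟨u, hu⟩ : ∃ u : Fin ε → U, ∀ i φ, g i φ = φ (u i) :=
    ⟨fun i => (Module.evalEquiv ℂ U).symm (g i), fun i φ => by simp⟩
  have hBu : ∀ i, B (u i) = v i.castSucc := fun i => by
    refine sub_eq_zero.1 ((Module.forall_dual_apply_eq_zero_iff ℂ _).1 fun φ => ?_)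
    rw [map_sub, ← hv, ← hfB, hu, LinearMap.dualMap_apply, sub_self]
  have hAu : ∀ i, A (u i) = v i.succ := fun i => by
    refine sub_eq_zero.1 ((Module.forall_dual_apply_eq_zero_iff ℂ _).1 fun φ => ?_)
    rw [map_sub, ← hv, ← hfA, hu, LinearMap.dualMap_apply, sub_self]
  have h1 := fun (c : Fin ε → ℂ) i =>
    rightSingular_fst_transpose_mulVec_castSucc (RingHom.id ℂ) c i
  have h2 := fun (c : Fin ε → ℂ) i => rightSingular_snd_transpose_mulVec_succ (RingHom.id ℂ) c i
  have h3 := fun (c : Fin ε → ℂ) => rightSingular_fst_transpose_mulVec_last (RingHom.id ℂ) c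
  have h4 := fun (c : Fin ε → ℂ) => rightSingular_snd_transpose_mulVec_zero (RingHom.id ℂ) c
  simp only [RingHom.coe_id, Matrix.map_id] at h1 h2 h3 h4
  have hl : ∀ w, x ε (B w) = 0 := fun w => by
    have : B.dualMap (x ε) = 0 := by rw [← h, hz (ε + 1) (by omega), map_zero]
    exact LinearMap.congr_fun this w
  let ξ := Fintype.linearCombination ℂ u
  let η := Fintype.linearCombination ℂ v
  have hBξ : ∀ c, B (ξ c) = η ((rightSingular ε).1ᵀ *ᵥ c) := fun c => by
    simp only [ξ, η, Fintype.linearCombination_apply, map_sum, map_smul, hBu]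
    rw [Fin.sum_univ_castSucc, h3, zero_smul, add_zero]
    simp only [h1]
  have hAξ : ∀ c, A (ξ c) = η ((rightSingular ε).2ᵀ *ᵥ c) := fun c => by
    simp only [ξ, η, Fintype.linearCombination_apply, map_sum, map_smul, hAu]
    rw [Fin.sum_univ_succ, h4, zero_smul, zero_add]
    simp only [h2]
  have hgB : ∀ w, LinearMap.pi (fun i : Fin (ε + 1) => x i) (B w) =
      (rightSingular ε).1ᵀ *ᵥ LinearMap.pi (fun i : Fin ε => x i ∘ₗ B) w := fun w => by
    refine funext fun i => Fin.lastCases ?_ (fun i => ?_) i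
    · rw [h3]; exact hl w
    · rw [h1]; rfl
  have hgA : ∀ w, LinearMap.pi (fun i : Fin (ε + 1) => x i) (A w) =
      (rightSingular ε).2ᵀ *ᵥ LinearMap.pi (fun i : Fin ε => x i ∘ₗ B) w := fun w => by
    refine funext fun i => Fin.cases ?_ (fun i => ?_) i
    · rw [h4]; exact LinearMap.congr_fun hA w
    · rw [h2]; exact LinearMap.congr_fun (h i) w
  refine HasBlockForm.of_retract (KBlock.left ε) _ _ ξ η hgB hgA hBξ hAξ
    (injective_pi_comp_linearCombination _ _ (Or.inr fun i j hij => ?_) fun i => ?_)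
    (injective_pi_comp_linearCombination _ _ (Or.inr fun i j hij => ?_) fun i => ?_)
    fun B' A' _ _ => ih _ _ B' A' fun htop => ?_
  · rw [LinearMap.comp_apply, hBu, ← hv]; exact hlow j.castSucc i.castSucc hij
  · rw [LinearMap.comp_apply, hBu, ← hv]; exact hdiag i.castSucc
  · rw [← hv]; exact hlow j i hij
  · rw [← hv]; exact hdiag i
  · have h0 : LinearMap.pi (fun i : Fin (ε + 1) => x i) (v 0) = 0 :=
      htop.ge (Submodule.mem_top : v 0 ∈ ⊤)
    exact hdiag 0 ((hv 0 _).trans (congrFun h0 (0 : Fin (ε + 1))))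

theorem IsJordanChain.exists_maximal [FiniteDimensional ℂ U] {A B : U →ₗ[ℂ] V}
    (hA : ¬ Function.Injective A) (hker : ∀ z ε, ¬ IsKernelChain A B z ε) :
    ∃ x k, IsJordanChain A B x (k + 1) ∧ ∀ z, ¬ IsJordanChain A B z (k + 2) := by
  rw [injective_iff_map_eq_zero] at hA
  push Not at hA
  obtain ⟨u, hu, hu0⟩ := hA
  classical
  let P : ℕ → Prop := fun k => ∃ x, IsJordanChain A B x (k + 1)
  have h0 : P 0 := ⟨fun _ => u, hu0, hu, fun i hi => by omega⟩
  obtain ⟨x, hx⟩ := Nat.findGreatest_spec (P := P) (Nat.zero_le (Module.finrank ℂ U)) h0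
  refine ⟨x, _, hx, fun z hz => ?_⟩
  have hle := hz.length_le hker
  have : Nat.findGreatest P (Module.finrank ℂ U) + 1 ≤ Nat.findGreatest P (Module.finrank ℂ U) :=
    Nat.le_findGreatest (P := P) (by omega) ⟨z, hz⟩
  omega

theorem jordanFinite_snd_mulVec (ν : ℂ) {k : ℕ} (c : Fin k → ℂ) :
    (jordanFinite ν k).2 *ᵥ c = superdiag k *ᵥ c - ν • c := by
  rw [jordanFinite, Matrix.add_mulVec, Matrix.smul_mulVec, Matrix.one_mulVec, neg_smul,
    sub_eq_neg_add]

/-- Splitting a Jordan block off: `A + ν B` is not injective and the pencil `λ B + (A + ν B)` has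
no kernel chains. -/
theorem HasBlockForm.of_finite_eigenvalue [FiniteDimensional ℂ U] {A B : U →ₗ[ℂ] V} (ν : ℂ)
    (hA : ¬ Function.Injective (A + ν • B)) (hker : ∀ z ε, ¬ IsKernelChain (A + ν • B) B z ε)
    (ih : ∀ (U' : Submodule ℂ U) (V' : Submodule ℂ V) (B' A' : U' →ₗ[ℂ] V'), U' ≠ ⊤ →
      ∃ K, HasBlockForm B' A' K) :
    ∃ K, HasBlockForm B A K := by
  obtain ⟨x, k, hx, hmax⟩ := IsJordanChain.exists_maximal hA hker
  obtain ⟨f, g, ξ, η, hgB, hgA, hBξ, hAξ, hf, hg⟩ := hx.exists_retract hmax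
  simp only [LinearMap.add_apply, LinearMap.smul_apply, map_add, map_smul, hgB, hBξ] at hgA hAξ
  refine HasBlockForm.of_retract (KBlock.jordan (ν : OnePoint ℂ) k.succPNat) f g ξ η (fun u => ?_)
    (fun u => ?_) (fun c => ?_) (fun c => ?_) hf hg fun B' A' hf' _ => ih _ _ B' A' fun htop => ?_
  · exact (hgB u).trans (Matrix.one_mulVec _).symm
  · exact (eq_sub_of_add_eq (hgA u)).trans (jordanFinite_snd_mulVec ν (f u)).symm
  · exact (hBξ c).trans (congrArg η (Matrix.one_mulVec _).symm)
  · refine Eq.trans ?_ (congrArg η (jordanFinite_snd_mulVec ν _).symm)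
    refine Eq.trans ?_ (map_sub η _ _).symm
    exact (eq_sub_of_add_eq (hAξ c)).trans (congrArg _ (map_smul η ν c).symm)
  · obtain ⟨u, hu⟩ := hf' (fun _ => 1)
    have hu0 : f u = 0 := htop.ge (Submodule.mem_top : u ∈ ⊤)
    exact zero_ne_one (congrFun (hu0.symm.trans hu) (0 : Fin (k + 1)))

/-- Splitting off a Jordan block with eigenvalue `∞`, by exchanging the roles of `A` and `B`. -/
theorem HasBlockForm.of_infinite_eigenvalue [FiniteDimensional ℂ U] {A B : U →ₗ[ℂ] V}
    (hB : ¬ Function.Injective B) (hker : ∀ z ε, ¬ IsKernelChain B A z ε)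
    (ih : ∀ (U' : Submodule ℂ U) (V' : Submodule ℂ V) (B' A' : U' →ₗ[ℂ] V'), U' ≠ ⊤ →
      ∃ K, HasBlockForm B' A' K) :
    ∃ K, HasBlockForm B A K := by
  obtain ⟨x, k, hx, hmax⟩ := IsJordanChain.exists_maximal hB hker
  obtain ⟨f, g, ξ, η, hgA, hgB, hAξ, hBξ, hf, hg⟩ := hx.exists_retract hmax
  refine HasBlockForm.of_retract (KBlock.jordan OnePoint.infty k.succPNat) f g ξ η (fun u => ?_)
    (fun u => ?_) (fun c => ?_) (fun c => ?_) hf hg fun B' A' hf' _ => ih _ _ B' A' fun htop => ?_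
  · exact hgB u
  · exact (hgA u).trans (Matrix.one_mulVec _).symm
  · exact hBξ c
  · exact (hAξ c).trans (congrArg η (Matrix.one_mulVec _).symm)
  · obtain ⟨u, hu⟩ := hf' (fun _ => 1)
    have hu0 : f u = 0 := htop.ge (Submodule.mem_top : u ∈ ⊤)
    exact zero_ne_one (congrFun (hu0.symm.trans hu) (0 : Fin (k + 1)))

end Kronecker

/-- Kronecker's theorem for a pencil of linear maps.  Without kernel chains of the pencil and of its
dual, both spaces have the same dimension, and there is an eigenvalue in `ℂ ∪ {∞}`. -/
theorem exists_hasBlockForm (N : ℕ) : ∀ (U V : Type) [AddCommGroup U] [Module ℂ U]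
    [FiniteDimensional ℂ U] [AddCommGroup V] [Module ℂ V] [FiniteDimensional ℂ V]
    (_ : Module.finrank ℂ U + Module.finrank ℂ V = N) (B A : U →ₗ[ℂ] V),
    ∃ K, HasBlockForm B A K := by
  induction N using Nat.strong_induction_on with
  | _ N ih =>
  intro U V _ _ _ _ _ _ hN B A
  have ihU : ∀ (U' : Submodule ℂ U) (V' : Submodule ℂ V) (B' A' : U' →ₗ[ℂ] V'), U' ≠ ⊤ →
      ∃ K, HasBlockForm B' A' K := fun U' V' B' A' h =>
    ih _ (by have := Submodule.finrank_lt h; have := V'.finrank_le; omega) U' V' rfl B' A'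
  have ihV : ∀ (U' : Submodule ℂ U) (V' : Submodule ℂ V) (B' A' : U' →ₗ[ℂ] V'), V' ≠ ⊤ →
      ∃ K, HasBlockForm B' A' K := fun U' V' B' A' h =>
    ih _ (by have := Submodule.finrank_lt h; have := U'.finrank_le; omega) U' V' rfl B' A'
  by_cases hc : ∃ ε z, IsKernelChain A B z ε
  · exact HasBlockForm.of_isKernelChain hc ihU
  by_cases hd : ∃ ε z, IsKernelChain A.dualMap B.dualMap z ε
  · exact HasBlockForm.of_isKernelChain_dual hd ihV
  have hdim : Module.finrank ℂ U = Module.finrank ℂ V := by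
    refine le_antisymm (not_lt.1 fun hlt => ?_) (not_lt.1 fun hlt => ?_)
    · obtain ⟨z, ε, h⟩ := exists_isKernelChain_of_finrank_lt A B hlt
      exact hc ⟨ε, z, h⟩
    · obtain ⟨z, ε, h⟩ := exists_isKernelChain_of_finrank_lt A.dualMap B.dualMap
        (by simpa only [Subspace.dual_finrank_eq] using hlt)
      exact hd ⟨ε, z, h⟩
  push Not at hc
  by_cases hA : Function.Injective A
  swap
  · refine HasBlockForm.of_finite_eigenvalue 0 ?_ ?_ ihU
    · simpa using hA
    · simpa using fun z ε => hc ε z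
  by_cases hB : Function.Injective B
  swap
  · exact HasBlockForm.of_infinite_eigenvalue hB
      (fun z ε => not_isKernelChain_of_injective hA) ihU
  rcases subsingleton_or_nontrivial U with hU | hU
  · have hV : Subsingleton V := by
      rw [← Module.finrank_zero_iff (R := ℂ), ← hdim, Module.finrank_zero_iff (R := ℂ)]
      exact hU
    exact ⟨⟨0, Fin.elim0⟩, 0, 0, fun _ i => i.elim0⟩
  · let eB := LinearEquiv.ofInjectiveOfFinrankEq B hB hdim
    obtain ⟨ν, hν⟩ := Module.End.exists_eigenvalue (eB.symm.toLinearMap ∘ₗ A)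
    obtain ⟨u, hu⟩ := hν.exists_hasEigenvector
    refine HasBlockForm.of_finite_eigenvalue (-ν) (fun hinj => hu.2 (hinj ?_))
      (fun z ε => not_isKernelChain_of_injective hB) ihU
    have h1 : A u = B (ν • u) := by
      have := hu.apply_eq_smul
      rw [LinearMap.comp_apply, LinearEquiv.coe_coe, LinearEquiv.symm_apply_eq] at this
      exact this
    simp [h1]

/-! ### Existence of the Kronecker canonical form -/

section Existence

open Matrix

variable {m n : ℕ}

/-- The invertible matrix of a linear automorphism of `ℂ^n`. -/
noncomputable def LinearEquiv.toGL (e : (Fin n → ℂ) ≃ₗ[ℂ] (Fin n → ℂ)) : GL (Fin n) ℂ where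
  val := LinearMap.toMatrix' e.toLinearMap
  inv := LinearMap.toMatrix' e.symm.toLinearMap
  val_inv := by rw [← LinearMap.toMatrix'_comp]; simp
  inv_val := by rw [← LinearMap.toMatrix'_comp]; simp

theorem blockDiagonal'_mulVec {S : Type*} [CommSemiring S] {r : ℕ} {R C : Fin r → ℕ}
    (N : (i : Fin r) → Matrix (Fin (R i)) (Fin (C i)) S) (v : (Σ i, Fin (C i)) → S) (i : Fin r)
    (a : Fin (R i)) :
    (Matrix.blockDiagonal' N *ᵥ v) ⟨i, a⟩ = (N i *ᵥ fun b => v ⟨i, b⟩) a := by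
  simp only [Matrix.mulVec, dotProduct, Fintype.sum_sigma]
  rw [Finset.sum_eq_single i]
  · simp [Matrix.blockDiagonal'_apply_eq]
  · intro j _ hj
    exact Finset.sum_eq_zero fun b _ => by
      rw [Matrix.blockDiagonal'_apply_ne _ _ _ (Ne.symm hj), zero_mul]
  · simp

theorem Pencil.IsKCF.of_hasBlockForm {L : Pencil (Fin m) (Fin n)} {K : KFamily}
    (h : HasBlockForm L.1.mulVecLin L.2.mulVecLin K) : Pencil.IsKCF L K := by
  obtain ⟨eU, eV, h⟩ := h
  have hn : Fintype.card (Σ i : Fin K.1, Fin (K.2 i).cols) = Fintype.card (Fin n) := by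
    have := eU.finrank_eq
    simpa [Module.finrank_pi_fintype] using this.symm
  have hm : Fintype.card (Σ i : Fin K.1, Fin (K.2 i).rows) = Fintype.card (Fin m) := by
    have := eV.finrank_eq
    simpa [Module.finrank_pi_fintype] using this.symm
  let f := Fintype.equivOfCardEq hn
  let e := Fintype.equivOfCardEq hm
  let q : (Fin n → ℂ) ≃ₗ[ℂ] (Fin n → ℂ) := eU.trans
    ((LinearEquiv.piCurry ℂ (fun (i : Fin K.1) (_ : Fin (K.2 i).cols) => ℂ)).symm.trans
      (LinearEquiv.funCongrLeft ℂ ℂ f.symm))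
  let p : (Fin m → ℂ) ≃ₗ[ℂ] (Fin m → ℂ) := eV.trans
    ((LinearEquiv.piCurry ℂ (fun (i : Fin K.1) (_ : Fin (K.2 i).rows) => ℂ)).symm.trans
      (LinearEquiv.funCongrLeft ℂ ℂ e.symm))
  have key : ∀ (T : Matrix (Fin m) (Fin n) ℂ)
      (N : (i : Fin K.1) → Matrix (Fin (K.2 i).rows) (Fin (K.2 i).cols) ℂ)
      (_ : ∀ u i, eV (T.mulVecLin u) i = N i *ᵥ eU u i),
      T = ((p.symm.toGL : GL (Fin m) ℂ) : Matrix (Fin m) (Fin m) ℂ) *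
        Matrix.reindex e f (Matrix.blockDiagonal' N) *
          ((q.toGL : GL (Fin n) ℂ) : Matrix (Fin n) (Fin n) ℂ) := by
    intro T N hT
    have h1 : ∀ u, p (T *ᵥ u) = Matrix.reindex e f (Matrix.blockDiagonal' N) *ᵥ q u := by
      intro u
      refine funext fun i => ?_
      obtain ⟨⟨j, a⟩, rfl⟩ := e.surjective i
      have h2 : (Matrix.reindex e f (Matrix.blockDiagonal' N) *ᵥ q u) (e ⟨j, a⟩) =
          (Matrix.blockDiagonal' N *ᵥ fun s => q u (f s)) ⟨j, a⟩ := by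
        simp only [Matrix.mulVec, dotProduct, Matrix.reindex_apply, Matrix.submatrix_apply,
          Equiv.symm_apply_apply]
        rw [← f.sum_comp]
        simp
      have h3 : ∀ s, q u (f s) = eU u s.1 s.2 := fun s => by
        simp only [q, LinearEquiv.trans_apply, LinearEquiv.funCongrLeft_apply,
          LinearMap.funLeft_apply]
        rw [f.symm_apply_apply]
        rfl
      have h4 : p (T *ᵥ u) (e ⟨j, a⟩) = eV (T *ᵥ u) j a := by
        simp only [p, LinearEquiv.trans_apply, LinearEquiv.funCongrLeft_apply,
          LinearMap.funLeft_apply]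
        rw [e.symm_apply_apply]
        rfl
      rw [h2, blockDiagonal'_mulVec, h4]
      simp only [h3]
      exact congrFun (hT u j) a
    apply Matrix.toLin'.injective
    refine LinearMap.ext fun u => ?_
    simp only [LinearEquiv.toGL, Matrix.toLin'_mul, LinearMap.comp_apply, Matrix.toLin'_toMatrix',
      LinearEquiv.coe_coe, Matrix.toLin'_apply]
    rw [LinearEquiv.eq_symm_apply, h1]
  exact ⟨e, f, p.symm.toGL, q.toGL, key _ _ fun u i => (h u i).1, key _ _ fun u i => (h u i).2⟩

/-- Kronecker's theorem: the canonical form chosen by `Pencil.kcf` is one. -/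
theorem Pencil.isKCF_kcf (L : Pencil (Fin m) (Fin n)) : Pencil.IsKCF L L.kcf := by
  obtain ⟨K, hK⟩ := exists_hasBlockForm _ (Fin n → ℂ) (Fin m → ℂ) rfl L.1.mulVecLin L.2.mulVecLin
  exact Classical.epsilon_spec_aux _ _ ⟨K, Pencil.IsKCF.of_hasBlockForm hK⟩

end Existence

/-! ### Kernels of the canonical blocks over an algebra -/

section Kernels

/-- Comparison of the dimensions of two kernels by a map injective on the first. -/
theorem finrank_ker_le_of_injOn {k E F E' F' : Type*} [Field k] [AddCommGroup E] [Module k E]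
    [AddCommGroup F] [Module k F] [AddCommGroup E'] [Module k E'] [AddCommGroup F'] [Module k F']
    [FiniteDimensional k E'] {T : E →ₗ[k] F} {T' : E' →ₗ[k] F'} (h : E →ₗ[k] E')
    (hmap : ∀ v, T v = 0 → T' (h v) = 0) (hinj : ∀ v, T v = 0 → h v = 0 → v = 0) :
    Module.finrank k (LinearMap.ker T) ≤ Module.finrank k (LinearMap.ker T') := by
  refine LinearMap.finrank_le_finrank_of_injective
    (f := (h ∘ₗ Submodule.subtype _).codRestrict (LinearMap.ker T') fun v => hmap v v.2) ?_
  rw [← LinearMap.ker_eq_bot, LinearMap.ker_eq_bot']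
  intro v hv
  exact Subtype.ext (hinj v v.2 (congrArg Subtype.val hv))

variable (k : Type*) {S : Type*} [Field k] [CommRing S] [Algebra k S]

theorem IsCoprime.eq_zero_of_mul {a b w : S} (h : IsCoprime a b) (ha : a * w = 0)
    (hb : b * w = 0) : w = 0 := by
  obtain ⟨u, v, huv⟩ := h
  linear_combination (-w) * huv + u * ha + v * hb

/-- The equations `a v i + b v (i + 1) = 0`, `a v p = 0` of a Jordan block. -/
def jordanSystem (a b : S) (p : ℕ) : (Fin (p + 1) → S) →ₗ[k] (Fin (p + 1) → S) :=
  LinearMap.pi (Fin.lastCases (LinearMap.mulLeft k a ∘ₗ LinearMap.proj (Fin.last p)) fun i =>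
    LinearMap.mulLeft k a ∘ₗ LinearMap.proj i.castSucc +
      LinearMap.mulLeft k b ∘ₗ LinearMap.proj i.succ)

theorem jordanSystem_eq_zero_iff (a b : S) (p : ℕ) (v : Fin (p + 1) → S) :
    jordanSystem k a b p v = 0 ↔
      (∀ i : Fin p, a * v i.castSucc + b * v i.succ = 0) ∧ a * v (Fin.last p) = 0 := by
  constructor
  · intro h
    refine ⟨fun i => ?_, ?_⟩
    · simpa [jordanSystem] using congrFun h i.castSucc
    · simpa [jordanSystem] using congrFun h (Fin.last p)
  · rintro ⟨h1, h2⟩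
    refine funext fun i => Fin.lastCases ?_ (fun i => ?_) i
    · simpa [jordanSystem] using h2
    · simpa [jordanSystem] using h1 i

/-- The solutions of the Jordan system are `v i = (-a) ^ i b ^ (p - i) w` with
`a ^ (p + 1) w = 0`. -/
theorem finrank_ker_jordanSystem [FiniteDimensional k S] {a b : S} (h : IsCoprime a b) (p : ℕ) :
    Module.finrank k (LinearMap.ker (jordanSystem k a b p)) =
      Module.finrank k (LinearMap.ker (LinearMap.mulLeft k (a ^ (p + 1)))) := by
  apply le_antisymm
  · have hpow : ∀ v, jordanSystem k a b p v = 0 →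
        ∀ i : Fin (p + 1), a ^ (p + 1 - (i : ℕ)) * v i = 0 := by
      intro v hv i
      rw [jordanSystem_eq_zero_iff] at hv
      induction i using Fin.reverseInduction with
      | last => simpa using hv.2
      | cast i ih =>
        have e1 : p + 1 - (i.castSucc : ℕ) = (p + 1 - (i.succ : ℕ)) + 1 := by
          simp only [Fin.val_castSucc, Fin.val_succ]; omega
        rw [e1, pow_succ]
        linear_combination a ^ (p + 1 - (i.succ : ℕ)) * hv.1 i - b * ih
    refine finrank_ker_le_of_injOn (LinearMap.proj 0) (fun v hv => ?_) fun v hv h0 => ?_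
    · simpa using hpow v hv 0
    · have h1 := (jordanSystem_eq_zero_iff k a b p v).1 hv
      refine funext fun i => ?_
      induction i using Fin.induction with
      | zero => exact h0
      | succ i ih =>
        refine (IsCoprime.pow_left (m := p + 1 - (i.succ : ℕ)) h).eq_zero_of_mul
          (hpow v hv i.succ) ?_
        have := h1.1 i
        rw [ih] at this
        simpa using this
  · refine finrank_ker_le_of_injOn
      (LinearMap.pi fun i => LinearMap.mulLeft k ((-a) ^ (i : ℕ) * b ^ (p - (i : ℕ))))
      (fun w hw => ?_) fun w hw h0 => ?_
    · rw [LinearMap.mulLeft_apply] at hw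
      rw [jordanSystem_eq_zero_iff]
      refine ⟨fun i => ?_, ?_⟩
      · simp only [LinearMap.pi_apply, LinearMap.mulLeft_apply, Fin.val_castSucc, Fin.val_succ]
        rw [show p - (i : ℕ) = (p - ((i : ℕ) + 1)) + 1 by omega]
        ring
      · simp only [LinearMap.pi_apply, LinearMap.mulLeft_apply, Fin.val_last, tsub_self, pow_zero,
          mul_one]
        rw [neg_pow]
        linear_combination (-1) ^ p * hw
    · have := congrFun h0 0
      simp only [LinearMap.pi_apply, LinearMap.mulLeft_apply, Fin.val_zero, pow_zero, one_mul,
        Pi.zero_apply] at this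
      exact (IsCoprime.pow (m := p + 1) (n := p) h).eq_zero_of_mul hw this

variable (φ : ℂ →+* S) (x y : S)

open Matrix

/-- The `k`-linear action of the pencil `x B + y A` on vectors over the `k`-algebra `S`, the complex
coefficients acting through `φ`. -/
def Pencil.evalMap {R C : Type} [Fintype C] (L : Pencil R C) : (C → S) →ₗ[k] (R → S) :=
  ((x • L.1.map φ + y • L.2.map φ).mulVecLin).restrictScalars k

theorem Pencil.evalMap_apply {R C : Type} [Fintype C] (L : Pencil R C) (v : C → S) (i : R) :
    L.evalMap k φ x y v i = x * (L.1.map φ *ᵥ v) i + y * (L.2.map φ *ᵥ v) i := by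
  rw [Pencil.evalMap, LinearMap.restrictScalars_apply, Matrix.mulVecLin_apply, Matrix.add_mulVec,
    Matrix.smul_mulVec, Matrix.smul_mulVec]
  rfl

/-- The value of `x B + y A` for the `1 × 1` Jordan block `λ B + A` with eigenvalue `ν`. -/
def eigenFactor : OnePoint ℂ → S
  | OnePoint.some ν => x - φ ν * y
  | OnePoint.infty => y

theorem jordanInfinite_evalMap (p : ℕ) :
    (jordanInfinite (p + 1)).evalMap k φ x y = jordanSystem k y x p := by
  refine LinearMap.ext fun v => funext fun i => ?_
  have h1 : ((1 : Matrix (Fin (p + 1)) (Fin (p + 1)) ℂ).map φ *ᵥ v) = v := by simp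
  rw [Pencil.evalMap_apply, jordanInfinite, h1]
  refine Fin.lastCases ?_ (fun i => ?_) i
  · rw [superdiag_mulVec_last φ v]
    simp [jordanSystem]
  · rw [superdiag_mulVec_castSucc φ v]
    simp [jordanSystem, add_comm]

theorem jordanFinite_evalMap (ν : ℂ) (p : ℕ) :
    (jordanFinite ν (p + 1)).evalMap k φ x y = jordanSystem k (x - φ ν * y) y p := by
  refine LinearMap.ext fun v => funext fun i => ?_
  have h1 : ((jordanFinite ν (p + 1)).1.map φ *ᵥ v) = v := by simp [jordanFinite]
  have h2 : (jordanFinite ν (p + 1)).2.map φ = (superdiag (p + 1)).map φ -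
      φ ν • (1 : Matrix (Fin (p + 1)) (Fin (p + 1)) S) := by
    ext a b
    simp [jordanFinite, Matrix.one_apply, apply_ite φ]
    ring
  rw [Pencil.evalMap_apply, h1, h2, Matrix.sub_mulVec, Matrix.smul_mulVec, Matrix.one_mulVec,
    Pi.sub_apply]
  refine Fin.lastCases ?_ (fun i => ?_) i
  · rw [superdiag_mulVec_last φ v]
    simp [jordanSystem]
    ring
  · rw [superdiag_mulVec_castSucc φ v]
    simp [jordanSystem]
    ring

theorem finrank_ker_evalMap_jordan [FiniteDimensional k S] (hxy : IsCoprime x y) (ν : OnePoint ℂ)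
    (p : ℕ+) :
    Module.finrank k (LinearMap.ker ((KBlock.jordan ν p).toPencil.evalMap k φ x y)) =
      Module.finrank k (LinearMap.ker (LinearMap.mulLeft k (eigenFactor φ x y ν ^ (p : ℕ)))) := by
  obtain ⟨q, rfl⟩ : ∃ q : ℕ, p = q.succPNat := ⟨p.natPred, by simp⟩
  cases ν with
  | infty =>
    change Module.finrank k (LinearMap.ker ((jordanInfinite (q + 1)).evalMap k φ x y)) = _
    rw [jordanInfinite_evalMap]
    exact finrank_ker_jordanSystem k hxy.symm q
  | coe ν =>
    have hco : IsCoprime (x - φ ν * y) y := by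
      simpa [sub_eq_add_neg] using hxy.add_mul_right_left (-φ ν)
    change Module.finrank k (LinearMap.ker ((jordanFinite ν (q + 1)).evalMap k φ x y)) = _
    rw [jordanFinite_evalMap]
    exact finrank_ker_jordanSystem k hco q

theorem finrank_ker_evalMap_right [FiniteDimensional k S] (hxy : IsUnit x ∨ IsUnit y) (p : ℕ) :
    Module.finrank k (LinearMap.ker ((KBlock.right p).toPencil.evalMap k φ x y)) =
      Module.finrank k S := by
  let T : (Fin (p + 1) → S) →ₗ[k] (Fin p → S) := (rightSingular p).evalMap k φ x y
  have hT : ∀ v i, T v i = x * v i.castSucc + y * v i.succ := fun v i => by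
    rw [Pencil.evalMap_apply, rightSingular_fst_mulVec, rightSingular_snd_mulVec]
  have htop : Module.finrank k (LinearMap.ker (0 : S →ₗ[k] S)) = Module.finrank k S := by
    rw [LinearMap.ker_zero, finrank_top]
  rw [← htop]
  change Module.finrank k (LinearMap.ker T) = _
  apply le_antisymm
  · rcases hxy with hx | hy
    · refine finrank_ker_le_of_injOn (LinearMap.proj (Fin.last p)) (fun v _ => rfl)
        fun v hv h0 => funext fun i => ?_
      induction i using Fin.reverseInduction with
      | last => exact h0
      | cast i ih =>
        have := hT v i
        rw [hv, ih] at this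
        exact hx.mul_right_eq_zero.1 (by simpa using this.symm)
    · refine finrank_ker_le_of_injOn (LinearMap.proj 0) (fun v _ => rfl)
        fun v hv h0 => funext fun i => ?_
      induction i using Fin.induction with
      | zero => exact h0
      | succ i ih =>
        have := hT v i
        rw [hv, ih] at this
        exact hy.mul_right_eq_zero.1 (by simpa using this.symm)
  · refine finrank_ker_le_of_injOn
      (LinearMap.pi fun i => LinearMap.mulLeft k ((-x) ^ (i : ℕ) * y ^ (p - (i : ℕ))))
      (fun w _ => funext fun i => ?_) fun w _ h0 => ?_
    · rw [hT]
      simp only [LinearMap.pi_apply, LinearMap.mulLeft_apply, Fin.val_castSucc, Fin.val_succ,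
        Pi.zero_apply]
      rw [show p - (i : ℕ) = (p - ((i : ℕ) + 1)) + 1 by omega]
      ring
    · rcases hxy with hx | hy
      · have := congrFun h0 (Fin.last p)
        simp only [LinearMap.pi_apply, LinearMap.mulLeft_apply, Fin.val_last, tsub_self, pow_zero,
          mul_one, Pi.zero_apply] at this
        exact (hx.neg.pow p).mul_right_eq_zero.1 this
      · have := congrFun h0 0
        simp only [LinearMap.pi_apply, LinearMap.mulLeft_apply, Fin.val_zero, pow_zero, one_mul,
          Pi.zero_apply] at this
        exact (hy.pow _).mul_right_eq_zero.1 this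

theorem finrank_ker_evalMap_left [FiniteDimensional k S] (hxy : IsUnit x ∨ IsUnit y) (p : ℕ) :
    Module.finrank k (LinearMap.ker ((KBlock.left p).toPencil.evalMap k φ x y)) = 0 := by
  let T : (Fin p → S) →ₗ[k] (Fin (p + 1) → S) :=
    Pencil.evalMap k φ x y ((rightSingular p).1ᵀ, (rightSingular p).2ᵀ)
  change Module.finrank k (LinearMap.ker T) = _
  suffices h : LinearMap.ker T = ⊥ by rw [h, finrank_bot]
  refine LinearMap.ker_eq_bot'.2 fun v hv => ?_
  have hT := fun i => (Pencil.evalMap_apply k φ x y ((rightSingular p).1ᵀ, (rightSingular p).2ᵀ)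
    v i).symm.trans (congrFun hv i)
  cases p with
  | zero => exact Subsingleton.elim _ _
  | succ p =>
    have h0 : x * v 0 = 0 := by
      have := hT 0
      rw [rightSingular_snd_transpose_mulVec_zero, ← Fin.castSucc_zero,
        rightSingular_fst_transpose_mulVec_castSucc] at this
      simpa using this
    have hl : y * v (Fin.last p) = 0 := by
      have := hT (Fin.last (p + 1))
      rw [rightSingular_fst_transpose_mulVec_last, ← Fin.succ_last,
        rightSingular_snd_transpose_mulVec_succ] at this
      simpa using this
    have hs : ∀ i : Fin p, x * v i.succ + y * v i.castSucc = 0 := fun i => by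
      have := hT i.succ.castSucc
      rw [rightSingular_fst_transpose_mulVec_castSucc, ← Fin.succ_castSucc,
        rightSingular_snd_transpose_mulVec_succ] at this
      simpa using this
    refine funext fun i => ?_
    rcases hxy with hx | hy
    · induction i using Fin.induction with
      | zero => exact hx.mul_right_eq_zero.1 h0
      | succ i ih =>
        have := hs i
        rw [ih] at this
        exact hx.mul_right_eq_zero.1 (by simpa using this)
    · induction i using Fin.reverseInduction with
      | last => exact hy.mul_right_eq_zero.1 hl
      | cast i ih =>
        have := hs i
        rw [ih] at this
        exact hy.mul_right_eq_zero.1 (by simpa using this)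

end Kernels

/-! ### The kernel of a pencil over an algebra -/

section KernelOfCanonicalForm

open Matrix

theorem finrank_ker_pi {k ι : Type*} [Field k] [Fintype ι] {E F : ι → Type*}
    [∀ i, AddCommGroup (E i)] [∀ i, Module k (E i)] [∀ i, FiniteDimensional k (E i)]
    [∀ i, AddCommGroup (F i)] [∀ i, Module k (F i)] (T : (i : ι) → E i →ₗ[k] F i) :
    Module.finrank k (LinearMap.ker (LinearMap.pi fun i => T i ∘ₗ LinearMap.proj i)) =
      ∑ i, Module.finrank k (LinearMap.ker (T i)) := by
  rw [← Module.finrank_pi_fintype k]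
  refine LinearEquiv.finrank_eq
    { toFun := fun v i => ⟨v.1 i, congrFun v.2 i⟩
      map_add' := fun _ _ => rfl
      map_smul' := fun _ _ => rfl
      invFun := fun w => ⟨fun i => w i, funext fun i => (w i).2⟩
      left_inv := fun _ => rfl
      right_inv := fun _ => rfl }

variable {m n : ℕ}

theorem Pencil.IsKCF.of_mem_orbit {L L' : Pencil (Fin m) (Fin n)} {K : KFamily}
    (h : Pencil.IsKCF L K) (hL' : L' ∈ Pencil.orbit L) : Pencil.IsKCF L' K := by
  obtain ⟨e, f, P, Q, h1, h2⟩ := h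
  obtain ⟨P', Q', h1', h2'⟩ := hL'
  refine ⟨e, f, P' * P, Q * Q', ?_, ?_⟩
  · rw [h1', h1]; simp [Matrix.mul_assoc]
  · rw [h2', h2]; simp [Matrix.mul_assoc]

variable (k : Type*) {S : Type*} [Field k] [CommRing S] [Algebra k S] (φ : ℂ →+* S) (x y : S)

/-- The kernel of a pencil over a `ℂ`-algebra is the direct sum of the kernels of the canonical
blocks. -/
theorem Pencil.IsKCF.finrank_ker_evalMap_eq_sum [FiniteDimensional k S]
    {L : Pencil (Fin m) (Fin n)} {K : KFamily} (hK : Pencil.IsKCF L K) :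
    Module.finrank k (LinearMap.ker (L.evalMap k φ x y)) =
      ∑ i, Module.finrank k (LinearMap.ker ((K.2 i).toPencil.evalMap k φ x y)) := by
  obtain ⟨e, f, P, Q, h1, h2⟩ := hK
  have hmap : ∀ {p : ℕ} (G : GL (Fin p) ℂ) (v : Fin p → S),
      (G⁻¹ : GL (Fin p) ℂ).1.map φ *ᵥ (G.1.map φ *ᵥ v) = v := by
    intro p G v
    rw [Matrix.mulVec_mulVec, ← Matrix.map_mul]
    simp
  have hmap' : ∀ {p : ℕ} (G : GL (Fin p) ℂ) (v : Fin p → S),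
      G.1.map φ *ᵥ ((G⁻¹ : GL (Fin p) ℂ).1.map φ *ᵥ v) = v := by
    intro p G v
    have := hmap G⁻¹ v
    rwa [inv_inv] at this
  let q : (Fin n → S) ≃ₗ[S] (Fin n → S) :=
    { (Q.1.map φ).mulVecLin with
      invFun := fun v => (Q⁻¹ : GL (Fin n) ℂ).1.map φ *ᵥ v
      left_inv := hmap Q
      right_inv := hmap' Q }
  let Φ : (Fin n → S) ≃ₗ[k] ((i : Fin K.1) → Fin (K.2 i).cols → S) :=
    (q.restrictScalars k).trans ((LinearEquiv.funCongrLeft k S f).trans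
      (LinearEquiv.piCurry k fun (i : Fin K.1) (_ : Fin (K.2 i).cols) => S))
  let T := LinearMap.pi fun i => (K.2 i).toPencil.evalMap k φ x y ∘ₗ
    LinearMap.proj (φ := fun i : Fin K.1 => Fin (K.2 i).cols → S) i
  have hblock : ∀ (N : (i : Fin K.1) → Matrix (Fin (K.2 i).rows) (Fin (K.2 i).cols) ℂ)
      (v : Fin n → S) (i : Fin K.1) (a : Fin (K.2 i).rows),
      ((Matrix.reindex e f (Matrix.blockDiagonal' N)).map φ *ᵥ (Q.1.map φ *ᵥ v)) (e ⟨i, a⟩) =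
        ((N i).map φ *ᵥ Φ v i) a := by
    intro N v i a
    have e1 : ((Matrix.reindex e f (Matrix.blockDiagonal' N)).map φ *ᵥ (Q.1.map φ *ᵥ v))
        (e ⟨i, a⟩) = (Matrix.blockDiagonal' (fun i => (N i).map φ) *ᵥ
          fun s => (Q.1.map φ *ᵥ v) (f s)) ⟨i, a⟩ := by
      have e2 : Matrix.blockDiagonal' (fun i => (N i).map φ) =
          (Matrix.blockDiagonal' N).map φ :=
        (Matrix.blockDiagonal'_map N φ (map_zero φ)).symm
      rw [e2]
      change ∑ j, φ (Matrix.blockDiagonal' N (e.symm (e ⟨i, a⟩)) (f.symm j)) *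
        (Q.1.map φ *ᵥ v) j = ∑ t, φ (Matrix.blockDiagonal' N ⟨i, a⟩ t) * (Q.1.map φ *ᵥ v) (f t)
      rw [← f.sum_comp]
      simp only [Equiv.symm_apply_apply]
    rw [e1, blockDiagonal'_mulVec]
    rfl
  have hkey : ∀ v, L.evalMap k φ x y v = 0 ↔ T (Φ v) = 0 := by
    intro v
    let N : Fin m → S :=
      x • ((Matrix.reindex e f K.toPencil.1).map φ *ᵥ (Q.1.map φ *ᵥ v)) +
        y • ((Matrix.reindex e f K.toPencil.2).map φ *ᵥ (Q.1.map φ *ᵥ v))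
    have hL : L.evalMap k φ x y v = P.1.map φ *ᵥ N := by
      refine funext fun i => ?_
      rw [Pencil.evalMap_apply, h1, h2]
      simp only [Matrix.map_mul, ← Matrix.mulVec_mulVec, N, Matrix.mulVec_add,
        Matrix.mulVec_smul]
      rfl
    have hN : ∀ i a, N (e ⟨i, a⟩) = T (Φ v) i a := by
      intro i a
      refine Eq.trans ?_ (Pencil.evalMap_apply k φ x y (K.2 i).toPencil (Φ v i) a).symm
      rw [← hblock (fun i => (K.2 i).toPencil.1), ← hblock (fun i => (K.2 i).toPencil.2)]
      rfl
    rw [hL]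
    constructor
    · intro h
      have hN0 : N = 0 := by
        rw [← hmap P N, h, Matrix.mulVec_zero]
      refine funext fun i => funext fun a => ?_
      rw [← hN, hN0]
      rfl
    · intro h
      have hN0 : N = 0 := by
        refine funext fun i => ?_
        obtain ⟨⟨j, a⟩, rfl⟩ := e.surjective i
        rw [hN, h]
        rfl
      rw [hN0, Matrix.mulVec_zero]
  rw [← finrank_ker_pi]
  apply le_antisymm
  · exact finrank_ker_le_of_injOn Φ.toLinearMap (fun v => (hkey v).1)
      fun v _ h => Φ.map_eq_zero_iff.1 h
  · refine finrank_ker_le_of_injOn Φ.symm.toLinearMap (fun v h => (hkey _).2 ?_)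
      fun v _ h => Φ.symm.map_eq_zero_iff.1 h
    rw [LinearEquiv.coe_coe, LinearEquiv.apply_symm_apply]
    exact h

/-- The dimension over `k` of the kernel of a canonical block over the `k`-algebra `S`. -/
noncomputable def KBlock.nullity : KBlock → ℕ
  | jordan ν p =>
    Module.finrank k (LinearMap.ker (LinearMap.mulLeft k (eigenFactor φ x y ν ^ (p : ℕ))))
  | right _ => Module.finrank k S
  | left _ => 0

theorem Pencil.IsKCF.finrank_ker_evalMap [FiniteDimensional k S] (hxy : IsUnit x ∨ IsUnit y)
    {L : Pencil (Fin m) (Fin n)} {K : KFamily} (hK : Pencil.IsKCF L K) :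
    Module.finrank k (LinearMap.ker (L.evalMap k φ x y)) =
      ∑ i, (K.2 i).nullity k φ x y := by
  rw [hK.finrank_ker_evalMap_eq_sum k φ x y]
  refine Finset.sum_congr rfl fun i _ => ?_
  have hco : IsCoprime x y := hxy.elim
    (fun h => (isCoprime_one_left.of_isCoprime_of_dvd_left h.dvd))
    fun h => (isCoprime_one_right.of_isCoprime_of_dvd_right h.dvd)
  cases K.2 i with
  | jordan ν p => exact finrank_ker_evalMap_jordan k φ x y hco ν p
  | right p => exact finrank_ker_evalMap_right k φ x y hxy p
  | left p => exact finrank_ker_evalMap_left k φ x y hxy p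

end KernelOfCanonicalForm

/-! ### The rank of a pencil -/

section Rank

variable {m n : ℕ}

/-- `1` for right singular blocks and `0` for all others. -/
def KBlock.rightIndicator : KBlock → ℕ
  | right _ => 1
  | _ => 0

/-- The number of right singular blocks of a family. -/
def KFamily.numRight (K : KFamily) : ℕ := ∑ i, (K.2 i).rightIndicator

theorem KFamily.numRight_mapEigenvalue (φ : OnePoint ℂ → OnePoint ℂ) (K : KFamily) :
    (K.mapEigenvalue φ).numRight = K.numRight := by
  refine Finset.sum_congr rfl fun i _ => ?_
  change ((K.2 i).mapEigenvalue φ).rightIndicator = _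
  cases K.2 i <;> rfl

/-- Over the field of rational functions only the right singular blocks have a kernel, and it is
one-dimensional. -/
theorem Pencil.IsKCF.rank_add_numRight {L : Pencil (Fin m) (Fin n)} {K : KFamily}
    (hK : Pencil.IsKCF L K) : L.rank + K.numRight = n := by
  have h1 := hK.finrank_ker_evalMap (RatFunc ℂ) (RatFunc.C : ℂ →+* RatFunc ℂ) RatFunc.X 1
    (Or.inr isUnit_one)
  have h2 : ∑ i, (K.2 i).nullity (RatFunc ℂ) (RatFunc.C : ℂ →+* RatFunc ℂ) RatFunc.X 1 =
      K.numRight := by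
    refine Finset.sum_congr rfl fun i _ => ?_
    cases K.2 i with
    | jordan ν p =>
      have hne : eigenFactor (RatFunc.C : ℂ →+* RatFunc ℂ) RatFunc.X 1 ν ≠ 0 := by
        cases ν with
        | infty => exact one_ne_zero
        | coe ν =>
          change RatFunc.X - RatFunc.C ν * 1 ≠ 0
          rw [mul_one, ← RatFunc.algebraMap_X, ← RatFunc.algebraMap_C, ← map_sub]
          exact RatFunc.algebraMap_ne_zero (Polynomial.X_sub_C_ne_zero ν)
      have hker : LinearMap.ker (LinearMap.mulLeft (RatFunc ℂ)
          (eigenFactor (RatFunc.C : ℂ →+* RatFunc ℂ) RatFunc.X 1 ν ^ (p : ℕ))) = ⊥ :=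
        LinearMap.ker_eq_bot'.2 fun w hw => (mul_eq_zero.1 hw).resolve_left (pow_ne_zero _ hne)
      rw [KBlock.nullity, hker, finrank_bot]
      rfl
    | right p => simp [KBlock.nullity, KBlock.rightIndicator]
    | left p => rfl
  have h3 : L.evalMap (RatFunc ℂ) (RatFunc.C : ℂ →+* RatFunc ℂ) RatFunc.X 1 =
      L.toRatFunc.mulVecLin := by
    rw [Pencil.evalMap, one_smul]
    rfl
  have h4 := LinearMap.finrank_range_add_finrank_ker L.toRatFunc.mulVecLin
  rw [← h3, h1, h2, h3] at h4
  simpa [Pencil.rank, Matrix.rank] using h4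

theorem Pencil.rank_eq_of_mem_bundle {L M : Pencil (Fin m) (Fin n)} (h : M ∈ Pencil.bundle L) :
    M.rank = L.rank := by
  obtain ⟨φ, -, L', ⟨K, hK, hK'⟩, hM⟩ := h
  have h1 := hK.rank_add_numRight
  have h2 := (hK'.of_mem_orbit hM).rank_add_numRight
  rw [KFamily.numRight_mapEigenvalue] at h2
  omega

end Rank

/-! ### The algebras `ℂ[X] / g` -/

section LocalAlgebra

open Polynomial

theorem AdjoinRoot.finrank_of_monic {g : ℂ[X]} (hg : g.Monic) :
    Module.finrank ℂ (AdjoinRoot g) = g.natDegree := by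
  rw [(AdjoinRoot.powerBasis' hg).finrank, AdjoinRoot.powerBasis'_dim]

/-- If `(X - z) ^ d` divides `g`, then the quotient `ℂ[X] / (X - z) ^ d` of `ℂ[X] / g` is annihilated
by `(X - z) ^ p` for `p ≥ d`, which bounds the range of the multiplication. -/
theorem le_finrank_ker_mulLeft_pow {g : ℂ[X]} (hg : g.Monic) {z : ℂ} {d p : ℕ}
    (hd : (X - C z) ^ d ∣ g) (hdp : d ≤ p) :
    d ≤ Module.finrank ℂ (LinearMap.ker (LinearMap.mulLeft ℂ
      ((AdjoinRoot.root g - AdjoinRoot.of g z) ^ p))) := by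
  have := hg.finite_adjoinRoot
  set q : ℂ[X] := (X - C z) ^ d with hq
  have hqm : q.Monic := (monic_X_sub_C z).pow d
  have := hqm.finite_adjoinRoot
  have hdeg : q.natDegree = d := by simp [hq]
  let π := (AdjoinRoot.algHomOfDvd ℂ g q hd).toLinearMap
  have hπ : Function.Surjective π := by
    intro w
    obtain ⟨f, rfl⟩ := AdjoinRoot.mk_surjective w
    refine ⟨AdjoinRoot.mk g f, ?_⟩
    simp only [π, AlgHom.toLinearMap_apply]
    rw [← AdjoinRoot.aeval_eq, ← AdjoinRoot.aeval_eq, ← Polynomial.aeval_algHom_apply,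
      AdjoinRoot.algHomOfDvd_root]
  have hzero : (AdjoinRoot.root q - AdjoinRoot.of q z) ^ p = 0 := by
    have h1 : (AdjoinRoot.root q - AdjoinRoot.of q z) = AdjoinRoot.mk q (X - C z) := by simp
    rw [h1, ← map_pow, AdjoinRoot.mk_eq_zero]
    exact pow_dvd_pow _ hdp
  have hle : LinearMap.range (LinearMap.mulLeft ℂ
      ((AdjoinRoot.root g - AdjoinRoot.of g z) ^ p)) ≤ LinearMap.ker π := by
    rintro _ ⟨w, rfl⟩
    rw [LinearMap.mem_ker, LinearMap.mulLeft_apply, AlgHom.toLinearMap_apply, map_mul, map_pow,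
      map_sub, AdjoinRoot.algHomOfDvd_root]
    have h2 : (AdjoinRoot.algHomOfDvd ℂ g q hd) (AdjoinRoot.of g z) = AdjoinRoot.of q z :=
      (AdjoinRoot.algHomOfDvd ℂ g q hd).commutes z
    rw [h2, hzero, zero_mul]
  have h3 := Submodule.finrank_mono hle
  have h4 := LinearMap.finrank_range_add_finrank_ker π
  have h5 := LinearMap.finrank_range_add_finrank_ker (LinearMap.mulLeft ℂ
      ((AdjoinRoot.root g - AdjoinRoot.of g z) ^ p))
  rw [LinearMap.range_eq_top.2 hπ, finrank_top, AdjoinRoot.finrank_of_monic hqm, hdeg] at h4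
  omega

/-- In `ℂ[X] / (X - z) ^ j` the kernel of `(X - z) ^ p`, for `p ≤ j`, is the image of
`(X - z) ^ (j - p)`. -/
theorem finrank_ker_mulLeft_pow_le (z : ℂ) (j p : ℕ) :
    Module.finrank ℂ (LinearMap.ker (LinearMap.mulLeft ℂ
      ((AdjoinRoot.root ((X - C z) ^ j) - AdjoinRoot.of ((X - C z) ^ j) z) ^ p))) ≤ min j p := by
  set g : ℂ[X] := (X - C z) ^ j with hg
  have hgm : g.Monic := (monic_X_sub_C z).pow j
  have := hgm.finite_adjoinRoot
  have hrank : Module.finrank ℂ (AdjoinRoot g) = j := by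
    rw [AdjoinRoot.finrank_of_monic hgm]; simp [hg]
  rcases le_total j p with hjp | hpj
  · rw [min_eq_left hjp]
    exact (Submodule.finrank_le _).trans hrank.le
  rw [min_eq_right hpj]
  have hmk : ∀ i, (AdjoinRoot.root g - AdjoinRoot.of g z) ^ i = AdjoinRoot.mk g ((X - C z) ^ i) := by
    intro i; simp
  have hle : LinearMap.ker (LinearMap.mulLeft ℂ ((AdjoinRoot.root g - AdjoinRoot.of g z) ^ p)) ≤
      LinearMap.range (LinearMap.mulLeft ℂ
        ((AdjoinRoot.root g - AdjoinRoot.of g z) ^ (j - p))) := by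
    intro w hw
    obtain ⟨f, rfl⟩ := AdjoinRoot.mk_surjective w
    rw [LinearMap.mem_ker, LinearMap.mulLeft_apply, hmk, ← map_mul, AdjoinRoot.mk_eq_zero, hg,
      ← Nat.add_sub_cancel' hpj, pow_add] at hw
    obtain ⟨r, rfl⟩ := (mul_dvd_mul_iff_left (pow_ne_zero p (X_sub_C_ne_zero z))).1 hw
    refine ⟨AdjoinRoot.mk g r, ?_⟩
    rw [LinearMap.mulLeft_apply, hmk, ← map_mul]
  have h1 := Submodule.finrank_mono hle
  have h2 := LinearMap.finrank_range_add_finrank_ker (LinearMap.mulLeft ℂ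
      ((AdjoinRoot.root g - AdjoinRoot.of g z) ^ (j - p)))
  have h3 := le_finrank_ker_mulLeft_pow hgm (z := z) (d := j - p) (p := j - p)
    (pow_dvd_pow _ (by omega)) le_rfl
  omega

theorem isUnit_root_sub_of (z ν : ℂ) (h : ν ≠ z) (j : ℕ) :
    IsUnit (AdjoinRoot.root ((X - C z) ^ j) - AdjoinRoot.of ((X - C z) ^ j) ν) := by
  obtain ⟨a, b, hab⟩ : IsCoprime (X - C ν) ((X - C z) ^ j) :=
    ((pairwise_coprime_X_sub_C Function.injective_id h).pow_right :)
  have := congrArg (AdjoinRoot.mk ((X - C z) ^ j)) hab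
  rw [map_add, map_mul, map_mul, AdjoinRoot.mk_self, mul_zero, add_zero, map_one, mul_comm] at this
  have hmk : AdjoinRoot.root ((X - C z) ^ j) - AdjoinRoot.of ((X - C z) ^ j) ν =
      AdjoinRoot.mk ((X - C z) ^ j) (X - C ν) := by simp
  rw [hmk]
  exact IsUnit.of_mul_eq_one _ this

/-- The matrix of multiplication by the root in the Newton basis `∏_{l < i} (X - α l)` of
`ℂ[X] / ∏ l, (X - α l)`. -/
def newtonMatrix {j : ℕ} (α : Fin j → ℂ) : Matrix (Fin j) (Fin j) ℂ :=
  Matrix.diagonal α + Matrix.of fun a b : Fin j => if (a : ℕ) = (b : ℕ) + 1 then (1 : ℂ) else 0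

theorem continuous_newtonMatrix {j : ℕ} : Continuous (newtonMatrix (j := j)) := by
  unfold newtonMatrix
  fun_prop

open Matrix in
/-- The coordinates of `ℂ[X] / ∏ l, (X - α l)` in the Newton basis.  The span of the Newton basis
contains `1` and is stable under multiplication by the root, so it is everything. -/
theorem exists_newton_equiv {j : ℕ} (α : Fin (j + 1) → ℂ) :
    ∃ e : (Fin (j + 1) → ℂ) ≃ₗ[ℂ] AdjoinRoot (∏ l, (X - C (α l))),
      ∀ v, AdjoinRoot.root _ * e v = e (newtonMatrix α *ᵥ v) := by
  set g : ℂ[X] := ∏ l, (X - C (α l)) with hg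
  have hgm : g.Monic := monic_prod_of_monic _ _ fun l _ => monic_X_sub_C _
  have := hgm.finite_adjoinRoot
  let t := AdjoinRoot.root g
  -- the partial products, continued by `0` from the full product on
  let N : ℕ → AdjoinRoot g := fun i =>
    ∏ l ∈ Finset.univ.filter fun l : Fin (j + 1) => (l : ℕ) < i, (t - AdjoinRoot.of g (α l))
  have hN : ∀ i : Fin (j + 1), t * N i = AdjoinRoot.of g (α i) * N i + N (i + 1) := by
    intro i
    have : N (i + 1) = (t - AdjoinRoot.of g (α i)) * N i := by
      have hf : (Finset.univ.filter fun l : Fin (j + 1) => (l : ℕ) < (i : ℕ) + 1) =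
          insert i (Finset.univ.filter fun l : Fin (j + 1) => (l : ℕ) < (i : ℕ)) := by
        ext l
        simp only [Finset.mem_filter, Finset.mem_univ, true_and, Finset.mem_insert, Fin.ext_iff]
        omega
      simp only [N, hf]
      rw [Finset.prod_insert (by simp)]
    rw [this]
    ring
  have hN0 : N 0 = 1 := by simp [N]
  have hNj : N (j + 1) = 0 := by
    have : N (j + 1) = AdjoinRoot.mk g (∏ l, (X - C (α l))) := by
      rw [map_prod]
      simp only [N, Finset.filter_true_of_mem (s := Finset.univ) fun l _ => Fin.is_lt l]
      simp [t]
    exact this.trans AdjoinRoot.mk_self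
  let E : (Fin (j + 1) → ℂ) →ₗ[ℂ] AdjoinRoot g :=
    Fintype.linearCombination ℂ fun i : Fin (j + 1) => N i
  have hsmul : ∀ (c : ℂ) (w : AdjoinRoot g), c • w = AdjoinRoot.of g c * w := fun c w =>
    Algebra.smul_def c w
  have hE : ∀ v, t * E v = E (newtonMatrix α *ᵥ v) := by
    intro v
    have hmul : ∀ a, (newtonMatrix α *ᵥ v) a = α a * v a +
        ∑ b : Fin (j + 1), if (a : ℕ) = (b : ℕ) + 1 then v b else 0 := by
      intro a
      rw [newtonMatrix, Matrix.add_mulVec, Pi.add_apply, Matrix.mulVec_diagonal]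
      simp [Matrix.mulVec, dotProduct]
    simp only [E, Fintype.linearCombination_apply, hmul, add_smul, Finset.sum_add_distrib,
      Finset.mul_sum, Finset.sum_smul]
    rw [Finset.sum_comm (f := fun (a b : Fin (j + 1)) =>
      (if (a : ℕ) = (b : ℕ) + 1 then v b else 0) • N a), ← Finset.sum_add_distrib]
    refine Finset.sum_congr rfl fun b _ => ?_
    have hs : ∑ a : Fin (j + 1), (if (a : ℕ) = (b : ℕ) + 1 then v b else 0) • N a =
        v b • N (b + 1) := by
      rcases Nat.lt_or_ge ((b : ℕ) + 1) (j + 1) with hb | hb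
      · rw [Finset.sum_eq_single ⟨(b : ℕ) + 1, hb⟩]
        · simp
        · intro a _ ha
          rw [if_neg fun h => ha (Fin.ext h), zero_smul]
        · simp
      · rw [show (b : ℕ) + 1 = j + 1 by omega, hNj, smul_zero]
        refine Finset.sum_eq_zero fun a _ => ?_
        rw [if_neg (by omega), zero_smul]
    rw [hs, mul_smul_comm, hN, smul_add, mul_comm (α b), mul_smul, hsmul (α b)]
  have hsurj : Function.Surjective E := by
    intro w
    obtain ⟨f, rfl⟩ := AdjoinRoot.mk_surjective w
    change AdjoinRoot.mk g f ∈ LinearMap.range E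
    have h1 : (1 : AdjoinRoot g) ∈ LinearMap.range E := by
      refine ⟨Pi.single 0 1, ?_⟩
      simp only [E, Fintype.linearCombination_apply_single, one_smul]
      exact hN0
    have hpow : ∀ i, t ^ i ∈ LinearMap.range E := by
      intro i
      induction i with
      | zero => simpa using h1
      | succ i ih =>
        obtain ⟨v, hv⟩ := ih
        exact ⟨newtonMatrix α *ᵥ v, by rw [← hE, hv, pow_succ']⟩
    induction f using Polynomial.induction_on' with
    | add p q hp hq => rw [map_add]; exact Submodule.add_mem _ hp hq
    | monomial i c =>
      have : AdjoinRoot.mk g (monomial i c) = c • t ^ i := by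
        rw [← C_mul_X_pow_eq_monomial, hsmul]; simp [t]
      rw [this]
      exact Submodule.smul_mem _ _ (hpow i)
  have hrank : Module.finrank ℂ (Fin (j + 1) → ℂ) = Module.finrank ℂ (AdjoinRoot g) := by
    rw [AdjoinRoot.finrank_of_monic hgm, hg, natDegree_finsetProd_X_sub_C_eq_card]
    simp
  exact ⟨LinearEquiv.ofBijective E
    ⟨(LinearMap.injective_iff_surjective_of_finrank_eq_finrank hrank).2 hsurj, hsurj⟩, hE⟩

end LocalAlgebra

/-! ### Semicontinuity of the kernel dimension -/

section Semicontinuity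

open Matrix

/-- Kernel dimensions of matrices are upper semicontinuous. -/
theorem eventually_finrank_ker_le {ι R C : Type*} [Fintype R] [Fintype C]
    {l : Filter ι} {T : ι → Matrix R C ℂ} {T₀ : Matrix R C ℂ}
    (hT : Filter.Tendsto T l (𝓝 T₀)) :
    ∀ᶠ i in l, Module.finrank ℂ (LinearMap.ker (T i).mulVecLin) ≤
      Module.finrank ℂ (LinearMap.ker T₀.mulVecLin) := by
  classical
  let Λ : Matrix R C ℂ →ₗ[ℂ] ((C → ℂ) →L[ℂ] (R → ℂ)) :=
    LinearMap.toContinuousLinearMap.toLinearMap ∘ₗ Matrix.toLin'.toLinearMap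
  have hΛ : Continuous Λ := Λ.continuous_of_finiteDimensional
  have hrk : ∀ S : Matrix R C ℂ, ((Λ S : (C → ℂ) →L[ℂ] (R → ℂ)) : (C → ℂ) →ₗ[ℂ] (R → ℂ)) =
      S.mulVecLin := fun S => rfl
  have hopen := (isOpen_setOfPred_nat_le_rank (𝕜 := ℂ) (E := C → ℂ) (F := R → ℂ)
    (Module.finrank ℂ (LinearMap.range T₀.mulVecLin))).preimage hΛ
  have hmem : T₀ ∈ Λ ⁻¹' {f : (C → ℂ) →L[ℂ] (R → ℂ) |
      (Module.finrank ℂ (LinearMap.range T₀.mulVecLin) : Cardinal) ≤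
        (f : (C → ℂ) →ₗ[ℂ] (R → ℂ)).rank} := by
    rw [Set.mem_preimage, Set.mem_ofPred_eq, hrk, LinearMap.rank, Module.finrank_eq_rank]
  filter_upwards [hT (hopen.mem_nhds hmem)] with i hi
  have hi' : (Module.finrank ℂ (LinearMap.range T₀.mulVecLin) : Cardinal) ≤
      (T i).mulVecLin.rank := hi
  rw [LinearMap.rank, ← Module.finrank_eq_rank, Nat.cast_le] at hi'
  have h1 := LinearMap.finrank_range_add_finrank_ker T₀.mulVecLin
  have h2 := LinearMap.finrank_range_add_finrank_ker (T i).mulVecLin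
  omega

open Kronecker in
/-- In coordinates of the algebra `S`, the pencil `x B + y A` over `S` becomes a complex matrix. -/
theorem finrank_ker_evalMap_eq_kronecker {m n j : ℕ} {S : Type*} [CommRing S] [Algebra ℂ S]
    (e : (Fin j → ℂ) ≃ₗ[ℂ] S) {x y : S} {X Y : Matrix (Fin j) (Fin j) ℂ}
    (hx : ∀ v, x * e v = e (X *ᵥ v)) (hy : ∀ v, y * e v = e (Y *ᵥ v))
    (L : Pencil (Fin m) (Fin n)) :
    Module.finrank ℂ (LinearMap.ker (L.evalMap ℂ (algebraMap ℂ S) x y)) =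
      Module.finrank ℂ (LinearMap.ker (L.1 ⊗ₖ X + L.2 ⊗ₖ Y).mulVecLin) := by
  have := Module.Finite.equiv e
  let E : ∀ p, (Fin p → S) ≃ₗ[ℂ] (Fin p × Fin j → ℂ) := fun p =>
    (LinearEquiv.piCongrRight fun _ : Fin p => e.symm).trans
      (LinearEquiv.curry ℂ ℂ (Fin p) (Fin j)).symm
  have hE : ∀ {p} (v : Fin p → S) i a, E p v (i, a) = e.symm (v i) a := fun v i a => rfl
  have hprod : ∀ (N : Matrix (Fin m) (Fin n) ℂ) (x : S) (X : Matrix (Fin j) (Fin j) ℂ)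
      (_ : ∀ v, x * e v = e (X *ᵥ v)) (v : Fin n → S) (i : Fin m) (a : Fin j),
      ((N ⊗ₖ X) *ᵥ E n v) (i, a) = e.symm (x * (N.map (algebraMap ℂ S) *ᵥ v) i) a := by
    intro N x X hX v i a
    have h1 : ∀ w, e.symm (x * w) = X *ᵥ e.symm w := fun w => by
      rw [LinearEquiv.symm_apply_eq, ← hX, LinearEquiv.apply_symm_apply]
    have h2 : (N.map (algebraMap ℂ S) *ᵥ v) i = ∑ c, N i c • v c := by
      simp [Matrix.mulVec, dotProduct, Algebra.smul_def]
    rw [h1, h2]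
    simp only [Matrix.mulVec, dotProduct, Fintype.sum_prod_type, Matrix.kroneckerMap_apply, hE,
      map_sum, map_smul, Finset.sum_apply, Pi.smul_apply, smul_eq_mul, Finset.mul_sum]
    rw [Finset.sum_comm]
    exact Finset.sum_congr rfl fun b _ => Finset.sum_congr rfl fun c _ => by ring
  have hkey : ∀ v, (L.1 ⊗ₖ X + L.2 ⊗ₖ Y).mulVecLin (E n v) =
      E m (L.evalMap ℂ (algebraMap ℂ S) x y v) := by
    intro v
    refine funext fun ⟨i, a⟩ => ?_
    rw [hE, Pencil.evalMap_apply, Matrix.mulVecLin_apply, Matrix.add_mulVec, Pi.add_apply,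
      hprod _ _ _ hx, hprod _ _ _ hy, map_add, Pi.add_apply]
  apply le_antisymm
  · refine finrank_ker_le_of_injOn (E n).toLinearMap (fun v hv => ?_)
      fun v _ h => (E n).map_eq_zero_iff.1 h
    rw [LinearEquiv.coe_coe, hkey, hv, map_zero]
  · refine finrank_ker_le_of_injOn (E n).symm.toLinearMap (fun v hv => ?_)
      fun v _ h => (E n).symm.map_eq_zero_iff.1 h
    apply (E m).map_eq_zero_iff.1
    rw [← hkey, LinearEquiv.coe_coe, LinearEquiv.apply_symm_apply, hv]

end Semicontinuity

/-! ### Affine charts of the Riemann sphere -/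

/-- The two standard affine charts of the Riemann sphere `ℂ ∪ {∞}`, with coordinates `ν` and
`1 / ν`. -/
inductive AffineChart : Type
  | finite
  | infinite

namespace AffineChart

/-- The homogeneous coordinate multiplying the coefficient of `λ`, at the point of the chart with
coordinate `t`. -/
def x {S : Type*} [One S] : AffineChart → S → S
  | finite, t => t
  | infinite, _ => 1

/-- The homogeneous coordinate multiplying the constant term, at the point of the chart with
coordinate `t`. -/
def y {S : Type*} [One S] : AffineChart → S → S
  | finite, _ => 1
  | infinite, t => t

/-- The affine coordinate; outside `AffineChart.domain` it has the arbitrary value `0`. -/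
noncomputable def coord : AffineChart → OnePoint ℂ → ℂ
  | finite, OnePoint.some ν => ν
  | finite, OnePoint.infty => 0
  | infinite, OnePoint.some ν => ν⁻¹
  | infinite, OnePoint.infty => 0

/-- The sphere without the point that the chart misses. -/
def domain : AffineChart → Set (OnePoint ℂ)
  | finite => {OnePoint.infty}ᶜ
  | infinite => {((0 : ℂ) : OnePoint ℂ)}ᶜ

theorem isOpen_domain (c : AffineChart) : IsOpen c.domain := by
  cases c <;> exact isOpen_compl_singleton

theorem exists_mem_domain (μ : OnePoint ℂ) : ∃ c : AffineChart, μ ∈ c.domain := by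
  cases μ with
  | infty => exact ⟨infinite, OnePoint.infty_ne_coe 0⟩
  | coe μ => exact ⟨finite, OnePoint.coe_ne_infty μ⟩

theorem isUnit_x_or_y {S : Type*} [CommRing S] (c : AffineChart) (t : S) :
    IsUnit (c.x t) ∨ IsUnit (c.y t) := by
  cases c
  · exact Or.inr isUnit_one
  · exact Or.inl isUnit_one

theorem coord_injOn (c : AffineChart) : Set.InjOn c.coord c.domain := by
  intro ν hν μ hμ h
  cases c <;> cases ν <;> cases μ
  · rfl
  · exact absurd rfl hν
  · exact absurd rfl hμ
  · exact congrArg _ h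
  · rfl
  · exact absurd (congrArg _ (inv_eq_zero.1 h.symm)) hμ
  · exact absurd (congrArg _ (inv_eq_zero.1 h)) hν
  · exact congrArg _ (inv_injective h)

theorem tendsto_coord (c : AffineChart) {μ : OnePoint ℂ} (hμ : μ ∈ c.domain) :
    Filter.Tendsto c.coord (𝓝 μ) (𝓝 (c.coord μ)) := by
  cases c <;> cases μ with
  | infty =>
    first
    | exact absurd rfl hμ
    | refine OnePoint.continuousAt_infty'.2 ?_
      rw [Filter.coclosedCompact_eq_cocompact, ← Metric.cobounded_eq_cocompact]
      exact Filter.tendsto_inv₀_cobounded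
  | coe μ =>
    refine OnePoint.continuousAt_coe.2 ?_
    first
    | exact continuousAt_id
    | exact continuousAt_inv₀ fun h => hμ (congrArg _ h)

variable {S : Type*} [CommRing S] (φ : ℂ →+* S) (t : S)

theorem exists_eigenFactor_eq (c : AffineChart) {ν : OnePoint ℂ} (hν : ν ∈ c.domain) :
    ∃ u : S, IsUnit u ∧ eigenFactor φ (c.x t) (c.y t) ν = u * (t - φ (c.coord ν)) := by
  cases c with
  | finite =>
    cases ν with
    | infty => exact absurd rfl hν
    | coe ν => exact ⟨1, isUnit_one, by simp [eigenFactor, x, y, coord]⟩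
  | infinite =>
    cases ν with
    | infty => exact ⟨1, isUnit_one, by simp [eigenFactor, y, coord]⟩
    | coe ν =>
      have h0 : ν ≠ 0 := fun h => hν (congrArg _ h)
      refine ⟨-φ ν, ((isUnit_iff_ne_zero.2 h0).map φ).neg, ?_⟩
      have h1 : φ ν * φ ν⁻¹ = 1 := by rw [← map_mul, mul_inv_cancel₀ h0, map_one]
      change 1 - φ ν * t = -φ ν * (t - φ ν⁻¹)
      linear_combination -h1

theorem eigenFactor_of_notMem (c : AffineChart) {ν : OnePoint ℂ} (hν : ν ∉ c.domain) :
    eigenFactor φ (c.x t) (c.y t) ν = 1 := by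
  cases c <;> rw [domain, Set.notMem_compl_iff, Set.mem_singleton_iff] at hν <;> subst hν
  · rfl
  · change 1 - φ 0 * t = 1
    rw [map_zero, zero_mul, sub_zero]

end AffineChart

/-! ### Kernel dimensions and Weyr characteristics -/

section Bounds

open Polynomial

theorem ker_mulLeft_pow_of_isUnit {S : Type*} [CommRing S] [Algebra ℂ S] {u : S} (hu : IsUnit u)
    (w : S) (p : ℕ) : LinearMap.ker (LinearMap.mulLeft ℂ ((u * w) ^ p)) =
      LinearMap.ker (LinearMap.mulLeft ℂ (w ^ p)) := by
  ext v
  rw [LinearMap.mem_ker, LinearMap.mem_ker, LinearMap.mulLeft_apply, LinearMap.mulLeft_apply,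
    mul_pow, mul_assoc, (hu.pow p).mul_right_eq_zero]

theorem ker_mulLeft_pow_eq_bot {S : Type*} [CommRing S] [Algebra ℂ S] {u : S} (hu : IsUnit u)
    (p : ℕ) : LinearMap.ker (LinearMap.mulLeft ℂ (u ^ p)) = ⊥ :=
  LinearMap.ker_eq_bot'.2 fun _ hv => (hu.pow p).mul_right_eq_zero.1 hv

variable {m n : ℕ}

/-- The eigenvalues `lam i` contribute to the kernel over `ℂ[X] / g` according to the
multiplicities of their coordinates as roots of `g`. -/
theorem Pencil.IsKCF.le_finrank_ker_evalMap {L : Pencil (Fin m) (Fin n)} {K : KFamily}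
    (hK : Pencil.IsKCF L K) (c : AffineChart) {g : ℂ[X]} (hg : g.Monic) {s : ℕ}
    {lam : Fin s → OnePoint ℂ} (hlam : Function.Injective lam) (hdom : ∀ i, lam i ∈ c.domain)
    {d : Fin s → ℕ} (hd : ∀ i, (X - C (c.coord (lam i))) ^ d i ∣ g) :
    K.numRight * g.natDegree + ∑ i, ∑ b, min (d i) ((K.2 b).sizeAt (lam i)) ≤
      Module.finrank ℂ (LinearMap.ker (L.evalMap ℂ (algebraMap ℂ (AdjoinRoot g))
        (c.x (AdjoinRoot.root g)) (c.y (AdjoinRoot.root g)))) := by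
  have := hg.finite_adjoinRoot
  rw [hK.finrank_ker_evalMap ℂ _ _ _ (c.isUnit_x_or_y _), KFamily.numRight, Finset.sum_comm,
    Finset.sum_mul, ← Finset.sum_add_distrib]
  refine Finset.sum_le_sum fun b _ => ?_
  cases K.2 b with
  | right p => simp [KBlock.rightIndicator, KBlock.nullity, KBlock.sizeAt,
      AdjoinRoot.finrank_of_monic hg]
  | left p => simp [KBlock.rightIndicator, KBlock.sizeAt]
  | jordan ν p =>
    simp only [KBlock.rightIndicator, zero_mul, zero_add, KBlock.sizeAt, KBlock.nullity]
    by_cases h : ∃ i, ν = lam i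
    · obtain ⟨i, rfl⟩ := h
      rw [Finset.sum_eq_single i (fun i' _ hi' => by
        rw [if_neg fun h => hi' (hlam h).symm, Nat.min_zero]) (by simp), if_pos rfl]
      obtain ⟨u, hu, hu'⟩ := c.exists_eigenFactor_eq (algebraMap ℂ (AdjoinRoot g))
        (AdjoinRoot.root g) (hdom i)
      rw [hu', ker_mulLeft_pow_of_isUnit hu]
      exact le_finrank_ker_mulLeft_pow hg ((pow_dvd_pow _ (min_le_left _ _)).trans (hd i))
        (min_le_right _ _)
    · push Not at h
      simp [h]

/-- Over `ℂ[X] / (X - z) ^ j`, where `z` is the coordinate of `μ`, only the right singular blocks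
and the Jordan blocks with eigenvalue `μ` contribute to the kernel. -/
theorem Pencil.IsKCF.finrank_ker_evalMap_le {L : Pencil (Fin m) (Fin n)} {K : KFamily}
    (hK : Pencil.IsKCF L K) (c : AffineChart) {g : ℂ[X]} {μ : OnePoint ℂ} (hμ : μ ∈ c.domain)
    {j : ℕ} (hg : g = (X - C (c.coord μ)) ^ j) :
    Module.finrank ℂ (LinearMap.ker (L.evalMap ℂ (algebraMap ℂ (AdjoinRoot g))
        (c.x (AdjoinRoot.root g)) (c.y (AdjoinRoot.root g)))) ≤
      K.numRight * j + ∑ b, min j ((K.2 b).sizeAt μ) := by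
  subst hg
  have hgm : ((X - C (c.coord μ)) ^ j).Monic := (monic_X_sub_C _).pow j
  have := hgm.finite_adjoinRoot
  rw [hK.finrank_ker_evalMap ℂ _ _ _ (c.isUnit_x_or_y _), KFamily.numRight,
    Finset.sum_mul, ← Finset.sum_add_distrib]
  refine Finset.sum_le_sum fun b _ => ?_
  cases K.2 b with
  | right p => simp [KBlock.rightIndicator, KBlock.nullity, AdjoinRoot.finrank_of_monic hgm]
  | left p => simp [KBlock.nullity]
  | jordan ν p =>
    simp only [KBlock.rightIndicator, zero_mul, zero_add, KBlock.sizeAt, KBlock.nullity]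
    by_cases hν : ν ∈ c.domain
    · obtain ⟨u, hu, hu'⟩ := c.exists_eigenFactor_eq (algebraMap ℂ (AdjoinRoot _))
        (AdjoinRoot.root ((X - C (c.coord μ)) ^ j)) hν
      rw [hu', ker_mulLeft_pow_of_isUnit hu]
      by_cases h : ν = μ
      · subst h
        rw [if_pos rfl]
        exact finrank_ker_mulLeft_pow_le _ j p
      · have hunit := isUnit_root_sub_of (c.coord μ) (c.coord ν)
          (fun h' => h (c.coord_injOn hν hμ h')) j
        have hker := ker_mulLeft_pow_eq_bot hunit p
        exact (congrArg (fun W : Submodule ℂ _ => Module.finrank ℂ W) hker).trans_le (by simp)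
    · rw [c.eigenFactor_of_notMem _ _ hν, ker_mulLeft_pow_eq_bot isUnit_one, finrank_bot]
      exact Nat.zero_le _

end Bounds

/-! ### Partial sums of unions of lists -/

section Lists

theorem sum_listSeq_range (l : List ℕ) (j : ℕ) :
    ∑ i ∈ Finset.range j, listSeq l i = ((l.take j).sum : ℤ) := by
  induction j generalizing l with
  | zero => simp
  | succ j ih =>
    cases l with
    | nil => simp [listSeq]
    | cons a l =>
      rw [Finset.sum_range_succ', List.take_succ_cons, List.sum_cons, Nat.cast_add, ← ih l,
        add_comm]
      rfl

/-- Among the sub-multisets of a non-increasing list with a given number of elements, the initial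
segment has the largest sum. -/
theorem Multiset.sum_le_sum_take {l : List ℕ} (hl : l.Pairwise (· ≥ ·)) {T : Multiset ℕ}
    (hT : T ≤ (l : Multiset ℕ)) : T.sum ≤ (l.take (Multiset.card T)).sum := by
  induction l generalizing T with
  | nil =>
    rw [Multiset.coe_nil, Multiset.le_zero] at hT
    simp [hT]
  | cons a l ih =>
    rw [List.pairwise_cons] at hl
    rw [← Multiset.cons_coe] at hT
    -- split off an element `b ≤ a` so that the rest is a sub-multiset of the tail
    have key : T = 0 ∨ ∃ b T', T = b ::ₘ T' ∧ b ≤ a ∧ T' ≤ (l : Multiset ℕ) := by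
      by_cases ha : a ∈ T
      · obtain ⟨T', rfl⟩ := Multiset.exists_cons_of_mem ha
        exact Or.inr ⟨a, T', rfl, le_rfl, (Multiset.cons_le_cons_iff a).1 hT⟩
      · have hT' := (Multiset.le_cons_of_notMem ha).1 hT
        rcases T.empty_or_exists_mem with rfl | ⟨b, hb⟩
        · exact Or.inl rfl
        · obtain ⟨T', rfl⟩ := Multiset.exists_cons_of_mem hb
          exact Or.inr ⟨b, T', rfl, hl.1 b (by simpa using Multiset.mem_of_le hT' hb),
            (Multiset.le_cons_self T' b).trans hT'⟩
    rcases key with rfl | ⟨b, T', rfl, hba, hT'⟩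
    · simp
    · rw [Multiset.sum_cons, Multiset.card_cons, List.take_succ_cons, List.sum_cons]
      exact add_le_add hba (ih hl.2 hT')

theorem Multiset.exists_eq_sum_of_le_sum {ι : Type*} [DecidableEq ι] {α : Type*} [DecidableEq α]
    (s : Finset ι) (a : ι → Multiset α) {T : Multiset α} (hT : T ≤ ∑ i ∈ s, a i) :
    ∃ t : ι → Multiset α, (∀ i ∈ s, t i ≤ a i) ∧ T = ∑ i ∈ s, t i := by
  induction s using Finset.induction_on generalizing T with
  | empty =>
    rw [Finset.sum_empty, Multiset.le_zero] at hT
    exact ⟨fun _ => 0, by simp, by simp [hT]⟩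
  | insert i s hi ih =>
    rw [Finset.sum_insert hi] at hT
    obtain ⟨t, ht, hsum⟩ := ih (T := T - a i) (tsub_le_iff_left.2 hT)
    refine ⟨Function.update t i (T ∩ a i), fun i' hi' => ?_, ?_⟩
    · rcases Finset.mem_insert.1 hi' with rfl | hi'
      · rw [Function.update_self]; exact Multiset.inter_le_right
      · rw [Function.update_of_ne (ne_of_mem_of_not_mem hi' hi)]; exact ht i' hi'
    · rw [Finset.sum_insert hi, Function.update_self]
      have h1 : ∑ i' ∈ s, Function.update t i (T ∩ a i) i' = ∑ i' ∈ s, t i' :=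
        Finset.sum_congr rfl fun i' hi' => Function.update_of_ne (ne_of_mem_of_not_mem hi' hi) _ _
      rw [h1, ← hsum, add_comm, Multiset.sub_add_inter]

/-- The largest entries of a union of non-increasing lists form initial segments of the lists. -/
theorem exists_sum_take_listUnion_le {s : ℕ} (l : Fin s → List ℕ)
    (hl : ∀ i, (l i).Pairwise (· ≥ ·)) (j : ℕ) :
    ∃ d : Fin s → ℕ, ∑ i, d i ≤ j ∧
      ((listUnion l).take j).sum ≤ ∑ i, ((l i).take (d i)).sum := by
  have hle : (((listUnion l).take j : List ℕ) : Multiset ℕ) ≤ ∑ i, (l i : Multiset ℕ) := by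
    have h1 : ((listUnion l : List ℕ) : Multiset ℕ) = ∑ i, (l i : Multiset ℕ) := by
      have h2 : ((listUnion l : List ℕ) : Multiset ℕ) = ((List.ofFn l).flatten : List ℕ) :=
        Multiset.coe_eq_coe.2 (List.perm_insertionSort _ _)
      rw [h2, ← List.sum_ofFn]
      have h3 : ∀ L : List (List ℕ), ((L.flatten : List ℕ) : Multiset ℕ) =
          (L.map fun a : List ℕ => (a : Multiset ℕ)).sum := by
        intro L
        induction L with
        | nil => rfl
        | cons a L ih => rw [List.flatten_cons, ← Multiset.coe_add, ih]; rfl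
      rw [h3, List.map_ofFn]
      rfl
    rw [← h1]
    exact Multiset.coe_le.2 (List.take_sublist _ _).subperm
  obtain ⟨t, ht, hsum⟩ := Multiset.exists_eq_sum_of_le_sum Finset.univ _ hle
  refine ⟨fun i => Multiset.card (t i), ?_, ?_⟩
  · rw [← Multiset.card_sum, ← hsum, Multiset.coe_card]
    exact List.length_take_le _ _
  · rw [← Multiset.sum_coe, hsum, Multiset.sum_sum]
    exact Finset.sum_le_sum fun i _ => Multiset.sum_le_sum_take (hl i) (ht i (Finset.mem_univ i))

theorem KFamily.pairwise_weyr (μ : OnePoint ℂ) (K : KFamily) :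
    (K.weyr μ).Pairwise (· ≥ ·) := by
  refine List.pairwise_map.2 (List.pairwise_lt_range.imp fun {a b} hab => ?_)
  refine Finset.card_le_card fun i hi => ?_
  rw [Finset.mem_filter] at hi ⊢
  exact ⟨hi.1, by omega⟩

/-- The sum of the first `j` Weyr numbers. -/
theorem KFamily.sum_take_weyr (μ : OnePoint ℂ) (K : KFamily) (j : ℕ) :
    ((K.weyr μ).take j).sum = ∑ b, min j ((K.2 b).sizeAt μ) := by
  have h1 : ((K.weyr μ).take j).sum = ∑ i ∈ Finset.range j, K.weyrEntry μ (i + 1) := by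
    have h0 : ((K.weyr μ).take j).sum =
        ∑ i ∈ Finset.range (min j (K.maxSizeAt μ)), K.weyrEntry μ (i + 1) := by
      rw [KFamily.weyr, ← List.map_take, List.take_range, ← Multiset.sum_coe]
      rfl
    rw [h0]
    refine Finset.sum_subset (fun i hi => ?_) fun i hi hi' => ?_
    · rw [Finset.mem_range] at hi ⊢; omega
    · rw [Finset.mem_range] at hi hi'
      refine Finset.card_eq_zero.2 (Finset.filter_eq_empty_iff.2 fun b _ hb => ?_)
      have : (K.2 b).sizeAt μ ≤ K.maxSizeAt μ :=
        Finset.le_sup (f := fun b => (K.2 b).sizeAt μ) (Finset.mem_univ b)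
      omega
  have h2 : ∀ p : ℕ, (Finset.range j).sum (fun i => if i + 1 ≤ p then 1 else 0) = min j p := by
    intro p
    rw [Finset.sum_boole]
    have : (Finset.range j).filter (fun i => i + 1 ≤ p) = Finset.range (min j p) := by
      ext i
      simp only [Finset.mem_filter, Finset.mem_range]
      omega
    rw [this]
    simp
  rw [h1]
  simp only [KFamily.weyrEntry, Finset.card_filter, ← h2]
  exact Finset.sum_comm

end Lists

/-! ### Limits of pencils -/

section Limits

open Polynomial Matrix Kronecker

theorem AffineChart.x_root_mul {j : ℕ} {S : Type*} [CommRing S] [Algebra ℂ S] (c : AffineChart)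
    {t : S} {N : Matrix (Fin j) (Fin j) ℂ} {e : (Fin j → ℂ) ≃ₗ[ℂ] S}
    (h : ∀ v, t * e v = e (N *ᵥ v)) (v : Fin j → ℂ) : c.x t * e v = e (c.x N *ᵥ v) := by
  cases c
  · exact h v
  · simp [AffineChart.x]

theorem AffineChart.y_root_mul {j : ℕ} {S : Type*} [CommRing S] [Algebra ℂ S] (c : AffineChart)
    {t : S} {N : Matrix (Fin j) (Fin j) ℂ} {e : (Fin j → ℂ) ≃ₗ[ℂ] S}
    (h : ∀ v, t * e v = e (N *ᵥ v)) (v : Fin j → ℂ) : c.y t * e v = e (c.y N *ᵥ v) := by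
  cases c
  · simp [AffineChart.y]
  · exact h v

/-- The pencil evaluated at the multiplication matrix of `ℂ[X] / ∏ l, (X - α l)`. -/
noncomputable def Pencil.newtonKronecker {m n j : ℕ} (c : AffineChart) (α : Fin j → ℂ)
    (L : Pencil (Fin m) (Fin n)) : Matrix (Fin m × Fin j) (Fin n × Fin j) ℂ :=
  L.1 ⊗ₖ c.x (newtonMatrix α) + L.2 ⊗ₖ c.y (newtonMatrix α)

theorem Pencil.continuous_newtonKronecker {m n j : ℕ} (c : AffineChart) :
    Continuous fun p : (Fin j → ℂ) × Pencil (Fin m) (Fin n) => p.2.newtonKronecker c p.1 := by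
  have hN : Continuous fun p : (Fin j → ℂ) × Pencil (Fin m) (Fin n) => newtonMatrix p.1 :=
    continuous_newtonMatrix.comp continuous_fst
  have hx : Continuous fun p : (Fin j → ℂ) × Pencil (Fin m) (Fin n) => c.x (newtonMatrix p.1) := by
    cases c
    · exact hN
    · exact continuous_const
  have hy : Continuous fun p : (Fin j → ℂ) × Pencil (Fin m) (Fin n) => c.y (newtonMatrix p.1) := by
    cases c
    · exact continuous_const
    · exact hN
  refine continuous_matrix fun a b => ?_
  simp only [Pencil.newtonKronecker, Matrix.add_apply, Matrix.kroneckerMap_apply]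
  exact (((continuous_snd.fst).matrix_elem _ _).mul (hx.matrix_elem _ _)).add
    (((continuous_snd.snd).matrix_elem _ _).mul (hy.matrix_elem _ _))

theorem Pencil.finrank_ker_newtonKronecker {m n j : ℕ} (c : AffineChart) (α : Fin (j + 1) → ℂ)
    (L : Pencil (Fin m) (Fin n)) :
    Module.finrank ℂ (LinearMap.ker (L.newtonKronecker c α).mulVecLin) =
      Module.finrank ℂ (LinearMap.ker (L.evalMap ℂ (algebraMap ℂ (AdjoinRoot (∏ l, (X - C (α l)))))
        (c.x (AdjoinRoot.root _)) (c.y (AdjoinRoot.root _)))) := by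
  obtain ⟨e, he⟩ := exists_newton_equiv α
  exact (finrank_ker_evalMap_eq_kronecker e (c.x_root_mul he) (c.y_root_mul he) L).symm

theorem theorem3p1 (m n s : ℕ) (L M : Pencil (Fin m) (Fin n)) (Mk : ℕ → Pencil (Fin m) (Fin n))
    (lam : Fin s → ℕ → OnePoint ℂ) (μ : OnePoint ℂ)
    (hbundle : ∀ k, Mk k ∈ Pencil.bundle L)
    (hdistinct : ∀ k, Function.Injective fun i => lam i k)
    (heig : ∀ i k, Pencil.IsEigenvalue (lam i k) (Mk k))
    (hweyr : ∀ i k₁ k₂,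
      Pencil.weyr (lam i k₁) (Mk k₁) = Pencil.weyr (lam i k₂) (Mk k₂))
    (hM : Filter.Tendsto Mk Filter.atTop (𝓝 M))
    (hlam : ∀ i, Filter.Tendsto (lam i) Filter.atTop (𝓝 μ)) :
    ∀ k, IsMajorizedBy
      (listSeq (listUnion fun i => Pencil.weyr (lam i k) (Mk k)))
      (fun j => listSeq (Pencil.weyr μ M) j + ((Pencil.rank L : ℤ) - (Pencil.rank M : ℤ))) := by
  intro k₀ j
  cases j with
  | zero => simp
  | succ j =>
  rw [Finset.sum_add_distrib, sum_listSeq_range, sum_listSeq_range, Finset.sum_const,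
    Finset.card_range, nsmul_eq_mul]
  -- `d i` of the `j + 1` largest entries of the union come from the `i`-th list
  obtain ⟨d, hdj, hd⟩ := exists_sum_take_listUnion_le
    (fun i => Pencil.weyr (lam i k₀) (Mk k₀)) (fun i => KFamily.pairwise_weyr _ _) (j + 1)
  obtain ⟨c, hc⟩ := AffineChart.exists_mem_domain μ
  -- `d i` of the nodes are put at the coordinate of `lam i k`, the remaining ones at that of `μ`
  obtain ⟨ι⟩ : Nonempty ((Σ i, Fin (d i)) ↪ Fin (j + 1)) :=
    Function.Embedding.nonempty_of_card_le (by simpa using hdj)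
  let α : ℕ → Fin (j + 1) → ℂ := fun k =>
    Function.extend ι (fun p => c.coord (lam p.1 k)) fun _ => c.coord μ
  have hα : Filter.Tendsto α Filter.atTop (𝓝 fun _ => c.coord μ) := by
    refine tendsto_pi_nhds.2 fun l => ?_
    by_cases hl : ∃ p, ι p = l
    · obtain ⟨p, rfl⟩ := hl
      simp only [α, ι.injective.extend_apply]
      exact (c.tendsto_coord hc).comp (hlam p.1)
    · simp only [α, Function.extend_apply' _ _ _ hl]
      exact tendsto_const_nhds
  have hpair : Filter.Tendsto (fun k => (α k, Mk k)) Filter.atTop (𝓝 (fun _ => c.coord μ, M)) :=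
    hα.prodMk_nhds hM
  have hT := ((Pencil.continuous_newtonKronecker c).tendsto _).comp hpair
  have hdom : ∀ᶠ k in Filter.atTop, ∀ i, lam i k ∈ c.domain :=
    Filter.eventually_all.2 fun i => hlam i (c.isOpen_domain.mem_nhds hc)
  obtain ⟨k, hk, hkdom⟩ := ((eventually_finrank_ker_le hT).and hdom).exists
  dsimp only [Function.comp_apply] at hk
  rw [Pencil.finrank_ker_newtonKronecker, Pencil.finrank_ker_newtonKronecker] at hk
  have hgm : (∏ l, (X - C (α k l))).Monic := monic_prod_of_monic _ _ fun l _ => monic_X_sub_C _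
  have hdvd : ∀ i, (X - C (c.coord (lam i k))) ^ d i ∣ ∏ l, (X - C (α k l)) := by
    intro i
    let κ : Fin (d i) ↪ Fin (j + 1) := (Function.Embedding.sigmaMk i).trans ι
    have h1 : ∏ l ∈ Finset.univ.map κ, (X - C (α k l)) =
        (X - C (c.coord (lam i k))) ^ d i := by
      rw [Finset.prod_map]
      have : ∀ a, α k (κ a) = c.coord (lam i k) := fun a =>
        ι.injective.extend_apply (fun p : Σ i, Fin (d i) => c.coord (lam p.1 k)) _ ⟨i, a⟩
      simp [this]
    rw [← h1]
    exact Finset.prod_dvd_prod_of_subset _ _ _ (Finset.subset_univ _)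
  have hlow := (Mk k).isKCF_kcf.le_finrank_ker_evalMap c hgm (hdistinct k) hkdom hdvd
  have hup := M.isKCF_kcf.finrank_ker_evalMap_le c (g := ∏ _l : Fin (j + 1), (X - C (c.coord μ)))
    hc (j := j + 1) (by simp)
  rw [natDegree_finsetProd_X_sub_C_eq_card, Finset.card_univ, Fintype.card_fin] at hlow
  have hfin := hlow.trans (hk.trans hup)
  simp only [← KFamily.sum_take_weyr] at hfin
  have hsum : ((listUnion fun i => Pencil.weyr (lam i k₀) (Mk k₀)).take (j + 1)).sum ≤
      ∑ i, ((KFamily.weyr (lam i k) (Mk k).kcf).take (d i)).sum := by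
    refine hd.trans_eq (Finset.sum_congr rfl fun i _ => ?_)
    rw [hweyr i k₀ k]
    rfl
  have hr := (Mk k).isKCF_kcf.rank_add_numRight
  have hrM := M.isKCF_kcf.rank_add_numRight
  rw [Pencil.rank_eq_of_mem_bundle (hbundle k)] at hr
  have hW : Pencil.weyr μ M = KFamily.weyr μ M.kcf := rfl
  rw [hW]
  have hdiff : ((L.rank : ℤ) - M.rank) = (M.kcf.numRight : ℤ) - (Mk k).kcf.numRight := by omega
  rw [hdiff]
  zify at hfin hsum
  push_cast at hfin hsum ⊢
  linarith

end Limits
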